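/- **Weights.** Let $\mathbf w=(w_i)_{i\ge 0}$ be nonnegative reals with $w_0>0$ and $w_k>0$ for some $k\ge 1$. Let $\phi(x)=\sum_i w_ix^i$, let $\rho\in[0,\infty]$ be its radius of convergence, $\psi(x)=x\phi'(x)/\phi(x)$ and, if $\rho>0$, $\nu=\lim_{x\uparrow\rho}\psi(x)$. - Regime 1: $\rho>0$ and $\nu\ge 1$; then $\tau\in[0,\rho]$, $\tau<\infty$, is the number with $\psi(\tau)=1$ (it is part of the assumption that there is one; it fails to exist only if $w_k=0$ for all $k\ge2$). - Regime 2: $\rho>0$ and $0<\nu<1$; then $\tau=\rho$. - Regime 3: $\rho=0$. In regimes 1 and 2 put $\pi_k=\tau^kw_k/\phi(\tau)$, $G(x)=\sum_k\pi_kx^k$, $m=\min(1,\nu)$, and $\hat\pi_k=k\pi_k$ for $k\in\mathbb N$, $\hat\pi_\infty=1-m$. **Colours.** In a finite tree colour a vertex green, red or orange according to whether it belongs to all, to none, or to some but not all of the vertex covers of minimal cardinality. **Trees.** Consider a spine $u_0,u_1,\dots$, where $u_k$ is the parent of $u_{k-1}$. For $k\ge1$ let $u_k$ have $N_k$ children,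 where the $N_k$ are independent with law $\hat\pi$. If $N_k<\infty$, then $u_{k-1}$ is a uniformly chosen one of these children; if $N_k=\infty$, then $u_{k-1}$ has infinitely many siblings on its left and on its right. Let $u_0$ and all children of $u_k$, $k\ge 1$, other than $u_{k-1}$, be roots of independent Bienaymé-Galton-Watson trees with offspring law $\pi$. In regime 1 the tree so obtained is $T_1^*$. In regime 2, $T_2^*$ consists of all descendants of $u_{j-1}$ (including itself), where $u_j$ is the second spine vertex with infinitely many children. In regime 3, $T_3^*$ consists of the vertex $u_1$ and its children, which are all leaves: $u_0$ and infinitely many others on each side of $u_0$. **Colours in these trees.** - $T_1^*$: call $u_k$ good if at least two of its children other than $u_{k-1}$ are red in the finite subtrees of their descendants. If there are infinitely many good vertices, a vertex $v$ has the colour $c$ if it has the colour $c$ in the finite subtree of the descendants of $u_k$, for every good ancestor $u_k$ of $v$ (including $v$ itself if it is good). - $T_2^*$: the vertex with infinitely many children is green; removing it leaves finite trees, whose vertices have their colours in these finite trees. - $T_3^*$: leaves are red and the root $u_1$ is green. Let $p_i(c)$ be the probability that $u_0$ has colour $c$ in $T_i^*$. Moreover, in regime 1 let $\tilde p_1(c)$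 be the probability that $u_0$ has colour $c$ in the subtree of the descendants of $u_k$ for all sufficiently large $k$. **Statement.** In regimes 1 and 2 the equation $q=G(1-q)$ has a unique solution $q\in[0,1]$. With this $q$: 1. In regime 1 if $w_k>0$ for some $k\ge3$ (with $p=p_1$), in regime 1 without this restriction (with $p=\tilde p_1$), and in regime 2 (with $p=p_2$), $$p(\text{green})=\frac{1-q+(1-2q)G'(1-q)}{1+G'(1-q)},\qquad p(\text{orange})=\frac{2qG'(1-q)}{1+G'(1-q)},\qquad p(\text{red})=\frac{q}{1+G'(1-q)}.$$ 2. In regime 3, $p_3(\text{red})=1$. -/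

import Mathlib

open Set Filter Topology MeasureTheory
open scoped NNReal ENNReal

noncomputable section

namespace TreeColour

/-! ### Weight sequences, the numbers `ρ`, `ν`, `τ`, and the laws `π` and `π̂` -/

/-- The radius of convergence `ρ` of the generating series `∑ w_i x^i`. -/
def radius (w : ℕ → ℝ≥0) : ℝ≥0∞ :=
  (FormalMultilinearSeries.ofScalars ℝ (fun i => (w i : ℝ))).radius

/-- `φ(x) = ∑ w_i x^i`, with values in `[0, ∞]`. -/
def phi (w : ℕ → ℝ≥0) (x : ℝ≥0∞) : ℝ≥0∞ := ∑' i : ℕ, (w i : ℝ≥0∞) * x ^ i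

/-- `ψ(x) = x φ'(x) / φ(x)`, the power series `x φ'(x)` being `∑ i w_i x^i`. -/
def psi (w : ℕ → ℝ≥0) (x : ℝ≥0∞) : ℝ≥0∞ :=
  (∑' i : ℕ, (i : ℝ≥0∞) * (w i : ℝ≥0∞) * x ^ i) / phi w x

/-- `ν = lim_{x ↑ ρ} ψ(x)`. -/
def nu (w : ℕ → ℝ≥0) : ℝ≥0∞ := limUnder (𝓝[<] radius w) (psi w)

/-- Regime 1, and `τ` is the number attached to `w` in that regime. -/
structure IsRegimeOne (w : ℕ → ℝ≥0) (τ : ℝ≥0∞) : Prop where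
  radius_pos : 0 < radius w
  one_le_nu : 1 ≤ nu w
  tau_le : τ ≤ radius w
  tau_lt_top : τ < ∞
  psi_tau : psi w τ = 1

/-- Regime 2, and `τ` is the number attached to `w` in that regime. -/
structure IsRegimeTwo (w : ℕ → ℝ≥0) (τ : ℝ≥0∞) : Prop where
  radius_pos : 0 < radius w
  nu_pos : 0 < nu w
  nu_lt_one : nu w < 1
  tau_eq : τ = radius w

/-- Regime 3. -/
def IsRegimeThree (w : ℕ → ℝ≥0) : Prop := radius w = 0

/-- `π_k = τ^k w_k / φ(τ)`. -/
def offspring (w : ℕ → ℝ≥0) (τ : ℝ≥0∞) (k : ℕ) : ℝ≥0∞ :=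
  τ ^ k * (w k : ℝ≥0∞) / phi w τ

/-- `π̂_k = k π_k` for finite `k`, and `π̂_∞ = 1 - m` with `m = min(1, ν)`. -/
def sizeBiased (w : ℕ → ℝ≥0) (τ : ℝ≥0∞) (k : ℕ∞) : ℝ≥0∞ :=
  if k = ⊤ then 1 - min 1 (nu w) else (k.toNat : ℝ≥0∞) * offspring w τ k.toNat

/-- The generating function `G` of `π`, as a function of a real variable. -/
def genFun (w : ℕ → ℝ≥0) (τ : ℝ≥0∞) (x : ℝ) : ℝ :=
  ∑' k : ℕ, (offspring w τ k).toReal * x ^ k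

open Classical in
/-- The probability measure with the masses `f a`. (If the masses do not sum up to `1`, which does
not happen for `π` and `π̂` in regimes 1 and 2, the value is a Dirac mass.) -/
def pmfOf {α : Type*} [Inhabited α] (f : α → ℝ≥0∞) : PMF α :=
  if h : HasSum f 1 then ⟨f, h⟩ else PMF.pure default

/-- The law `π` on `ℕ`. -/
def offspringLaw (w : ℕ → ℝ≥0) (τ : ℝ≥0∞) : PMF ℕ := pmfOf (offspring w τ)

/-- The law `π̂` on `ℕ ∪ {∞}`. -/
def sizeBiasedLaw (w : ℕ → ℝ≥0) (τ : ℝ≥0∞) : PMF ℕ∞ := pmfOf (sizeBiased w τ)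

/-- Among `n` ordered children one is chosen uniformly at random: the law of the pair (number of
children to its left, number of children to its right). -/
def positionLaw : ℕ → PMF (ℕ∞ × ℕ∞)
  | 0 => PMF.pure (0, 0)
  | n + 1 => (PMF.uniformOfFintype (Fin (n + 1))).map
      (fun j => (((j : ℕ) : ℕ∞), ((n - (j : ℕ) : ℕ) : ℕ∞)))

/-- The law of the pair (number of siblings of `u_{k-1}` to its left, to its right) for `k ≥ 1`:
`u_k` has `N` children, where `N` has the law `π̂`; for finite `N` the vertex `u_{k-1}` is a
uniformly chosen child; for `N = ∞` it has infinitely many siblings on both sides. -/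
def siblingLaw (w : ℕ → ℝ≥0) (τ : ℝ≥0∞) : PMF (ℕ∞ × ℕ∞) :=
  (sizeBiasedLaw w τ).bind
    (fun N => if N = ⊤ then PMF.pure (⊤, ⊤) else positionLaw N.toNat)

/-! ### The ambient tree with an infinite ancestral line -/

/-- The ambient tree consists of the spine `u_0, u_1, …` and of copies of the Ulam-Harris tree,
rooted at the following places: `none` stands for `u_0`, and `some (k, false, i)`
(resp. `some (k, true, i)`) for the `i`-th child of `u_{k+1}` to the left (resp. to the right) of
`u_k`, counted from `u_k` outwards. All counting starts with `0`. -/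
abbrev Base : Type := Option (ℕ × Bool × ℕ)

/-- The vertices of the ambient tree. -/
inductive Vertex : Type
  /-- `spine k` is the vertex `u_{k+1}`. -/
  | spine (k : ℕ) : Vertex
  /-- `bush b a` is the vertex with the word `a` in the Ulam-Harris tree rooted at `b`. -/
  | bush (b : Base) (a : List ℕ) : Vertex

/-- The spine vertices `u_0, u_1, u_2, …`. -/
def u : ℕ → Vertex
  | 0 => Vertex.bush none []
  | k + 1 => Vertex.spine k

/-- The parent of a vertex of the ambient tree. -/
def parent : Vertex → Vertex
  | Vertex.spine k => u (k + 2)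
  | Vertex.bush none [] => u 1
  | Vertex.bush (some (k, _, _)) [] => u (k + 1)
  | Vertex.bush b (a :: l) => Vertex.bush b (a :: l).dropLast

/-- `x` is a descendant of `v` (every vertex is a descendant of itself). -/
def Descends (x v : Vertex) : Prop := ∃ n : ℕ, parent^[n] x = v

/-- The part of `t` that descends from `v`. -/
def below (t : Set Vertex) (v : Vertex) : Set Vertex := {x ∈ t | Descends x v}

/-- The graph whose edges are the edges of the ambient tree with both ends in `t`. -/
def graphOn (t : Set Vertex) : SimpleGraph Vertex :=
  SimpleGraph.fromRel (fun x y => x ∈ t ∧ y ∈ t ∧ parent x = y)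

/-! ### The tricolouration of a finite tree -/

/-- The three colours. -/
inductive Colour : Type
  | green
  | orange
  | red

/-- A covering (vertex cover) of minimal cardinality. Vertices that meet no edge never belong to
one. -/
def IsSmallestCovering {V : Type*} (H : SimpleGraph V) (S : Finset V) : Prop :=
  H.IsVertexCover (S : Set V) ∧ ∀ S' : Finset V, H.IsVertexCover (S' : Set V) → S.card ≤ S'.card

open Classical in
/-- The colour of `v` in a graph with finitely many edges: green, red, orange when `v` belongs to
all, to none, to some but not all smallest coverings. -/
def tricolour {V : Type*} (H : SimpleGraph V) (v : V) : Colour :=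
  if ∀ S : Finset V, IsSmallestCovering H S → v ∈ S then Colour.green
  else if ∀ S : Finset V, IsSmallestCovering H S → v ∉ S then Colour.red
  else Colour.orange

/-- The colour of `v` in the finite tree with vertex set `t`. -/
def colourIn (t : Set Vertex) (v : Vertex) : Colour := tricolour (graphOn t) v

/-! ### The tricolourations of the three kinds of infinite trees -/

/-- `x` is a child of `u_k` in `t`, distinct from `u_{k-1}`, and it is red in the tricolouration of
the subtree of its descendants. -/
def IsRedSideChild (t : Set Vertex) (k : ℕ) (x : Vertex) : Prop :=
  x ∈ t ∧ parent x = u k ∧ (∀ j, j + 1 = k → x ≠ u j) ∧ colourIn (below t x) x = Colour.red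

/-- The vertex `u_k` of `t` is good: at least two of its children, distinct from `u_{k-1}`, are red
in the tricolouration of the subtree they produce. -/
def IsGood (t : Set Vertex) (k : ℕ) : Prop :=
  u k ∈ t ∧ ∃ x y, x ≠ y ∧ IsRedSideChild t k x ∧ IsRedSideChild t k y

/-- The vertex `v` has the colour `c` in a tree `t` like `T_1^*`: there are infinitely many good
vertices, and `v` has the colour `c` in the subtree below each good vertex that is an ancestor of
`v`. -/
def HasColourOne (t : Set Vertex) (v : Vertex) (c : Colour) : Prop :=
  v ∈ t ∧ {k | IsGood t k}.Infinite ∧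
    ∀ k, IsGood t k → Descends v (u k) → colourIn (below t (u k)) v = c

/-- The colour of `v` in the subtree below `u_k` is `c` for all sufficiently large `k`. -/
def HasLimitColour (t : Set Vertex) (v : Vertex) (c : Colour) : Prop :=
  v ∈ t ∧ ∀ᶠ k in atTop, colourIn (below t (u k)) v = c

/-- The vertices of infinite degree in `t`. -/
def infiniteDegree (t : Set Vertex) : Set Vertex :=
  {x ∈ t | {y | (graphOn t).Adj x y}.Infinite}

open Classical in
/-- The colour of `v` in a tree `t` like `T_2^*`: the vertex of infinite degree is green, and the
other vertices have their colours in the components that remain when this vertex is cut out. -/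
def colourTwo (t : Set Vertex) (v : Vertex) : Colour :=
  if v ∈ infiniteDegree t then Colour.green
  else colourIn {x | (graphOn (t \ infiniteDegree t)).Reachable v x} v

open Classical in
/-- The colour of `v` in a tree `t` like `T_3^*`: leaves are red and the root is green. -/
def colourThree (t : Set Vertex) (v : Vertex) : Colour :=
  if ∃ x ∈ t, parent x = v then Colour.green else Colour.red

/-! ### The limiting random trees -/

/-- The membership of a word in the plane tree in which the vertex with the word `a` has `ξ a`
children (numbered `0, …, ξ a - 1`). -/
def InPlaneTree : (List ℕ → ℕ) → List ℕ → Prop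
  | _, [] => True
  | ξ, i :: a => i < ξ [] ∧ InPlaneTree (fun b => ξ (i :: b)) a

/-- The random input: the numbers of children of the vertices in the attached
Bienaymé-Galton-Watson trees, and for each `k` the numbers of siblings of `u_k` to its left and to
its right. -/
abbrev Sample : Type := (Base × List ℕ → ℕ) × (ℕ → ℕ∞ × ℕ∞)

/-- All these random variables are independent, the first ones with the law `π`, the second ones
with the law `siblingLaw`. -/
def sampleLaw (w : ℕ → ℝ≥0) (τ : ℝ≥0∞) : Measure Sample :=
  (Measure.infinitePi (fun _ : Base × List ℕ => (offspringLaw w τ).toMeasure)).prod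
    (Measure.infinitePi (fun _ : ℕ => (siblingLaw w τ).toMeasure))

/-- Which of the possible roots of attached trees are present. -/
def BasePresent (s : ℕ → ℕ∞ × ℕ∞) : Base → Prop
  | none => True
  | some (k, false, i) => (i : ℕ∞) < (s k).1
  | some (k, true, i) => (i : ℕ∞) < (s k).2

/-- The tree with the whole spine `u_0, u_1, …`, the siblings of the `u_k`, and the trees attached
to `u_0` and to all these siblings. In regime 1 this is `T_1^*`. -/
def treeOne (ω : Sample) : Set Vertex :=
  {x | match x with
    | Vertex.spine _ => True
    | Vertex.bush b a => BasePresent ω.2 b ∧ InPlaneTree (fun l => ω.1 (b, l)) a}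

/-- `u_{k+1}` has infinitely many children. -/
def InfiniteAt (s : ℕ → ℕ∞ × ℕ∞) (k : ℕ) : Prop := (s k).1 + (s k).2 = ⊤

/-- `u_{k+1}` is the second vertex on the spine that has infinitely many children. -/
def SecondInfiniteAt (s : ℕ → ℕ∞ × ℕ∞) (k : ℕ) : Prop :=
  InfiniteAt s k ∧ ∃! i, i < k ∧ InfiniteAt s i

/-- The tree `T_2^*`: if `u_j` is the second vertex on the spine with infinitely many children, all
descendants of `u_{j-1}` are kept. -/
def treeTwo (ω : Sample) : Set Vertex :=
  {x ∈ treeOne ω | ∃ k, SecondInfiniteAt ω.2 k ∧ Descends x (u k)}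

/-- The tree `T_3^*`: the vertex `u_1` with infinitely many children to the left and to the right
of its child `u_0`, all of them leaves. -/
def treeThree : Set Vertex := {x | x = u 1 ∨ parent x = u 1}

/-! ### The law of the colour of `u_0` -/

/-- `p_1(c)`. -/
def probOne (w : ℕ → ℝ≥0) (τ : ℝ≥0∞) (c : Colour) : ℝ :=
  (sampleLaw w τ).real {ω | HasColourOne (treeOne ω) (u 0) c}

/-- `p_1(c)`, for the eventual colour. -/
def probLimit (w : ℕ → ℝ≥0) (τ : ℝ≥0∞) (c : Colour) : ℝ :=
  (sampleLaw w τ).real {ω | HasLimitColour (treeOne ω) (u 0) c}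

/-- `p_2(c)`. -/
def probTwo (w : ℕ → ℝ≥0) (τ : ℝ≥0∞) (c : Colour) : ℝ :=
  (sampleLaw w τ).real {ω | colourTwo (treeTwo ω) (u 0) = c}

/-- `p_3(c)`; the law of `T_3^*` is a Dirac mass. -/
def probThree (c : Colour) : ℝ :=
  ((PMF.pure treeThree).toOuterMeasure {t | colourThree t (u 0) = c}).toReal

/-- The claimed law of the colour of `u_0`, where `d` stands for `G'(1-q)`. -/
def IsColourLaw (p : Colour → ℝ) (q d : ℝ) : Prop :=
  p Colour.green = (1 - q + (1 - 2 * q) * d) / (1 + d) ∧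
  p Colour.orange = 2 * q * d / (1 + d) ∧
  p Colour.red = q / (1 + d)

end TreeColour

end

open TreeColour

/-! In a finite graph with root `v`, let the smallest coverings that contain `v` have m + 1 elements
and those that avoid it m + e. The excess e decides the colour of `v`: 0 is red, 1 is orange, at
least 2 is green. Attaching at `v`, by an edge to its root, a graph of excess e' raises e by one if
e' = 0 and leaves it unchanged otherwise (`HasExcess.union`). Hence in a tree the excess of the root
is the number of its children that are red in their own subtrees.

The subtree below u_K is now rerooted at u_0: each u_j carries its side trees and, as one more
child, everything above it, rooted at u_{j+1}. Let u_{n+1} be the first of u_1, u_2, … with a red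
side child. Its excess is positive whatever lies above, so its ancestors have no influence on u_0.
At u_n, u_{n-1}, …, u_1 the excesses are 0, 1, 0, 1, …, and u_0 ends up with B + [n odd], where B is
its number of red children (`hasExcess_below`). This gives the eventual colour and the colour below
every good vertex. In the second kind of tree the deleted vertex of infinite degree stops the
influence with the same parity rule.

For the probabilities, G' < 1 on [0, 1) leaves 1 as the only fixed point of G in [0, 1], so the
attached trees are almost surely finite. The probability q of a red root then solves q = G(1 - q),
and it is the only solution because G(1 - q) is nonincreasing in q. With d = G'(1 - q), B takes the
values 0 and 1 with probabilities q and qd. Independently of B, each spine vertex fails to block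
with probability ∑ k π_k (1 - q)^(k-1) = d, since size biasing produces the derivative and
infinitely many siblings always block. So n is geometric and is odd with probability d / (1 + d)
(`infinitePi_oddFirst`); `isColourLaw_of_ae` combines the two.

Regimes 1 and 2 enter through `IsSubcritical`, which in regime 2 rests on the monotonicity of ψ, and
through the almost sure shape of the spine. Regime 3 is immediate. -/

namespace TreeColour

/-! ### Smallest coverings of rooted graphs -/

section Cover

variable {V : Type*} {r : V → V → Prop} {a b t : Set V} {S : Finset V} {v n : V} {e e' : ℕ}

/-- `S` covers the edges of the relation `r` with both ends in `t`. -/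
def Covers (r : V → V → Prop) (t : Set V) (S : Finset V) : Prop :=
  ∀ x ∈ t, ∀ y ∈ t, r x y → x ≠ y → x ∈ S ∨ y ∈ S

/-- The smallest coverings of `t` that avoid `v` have `e - 1` more elements than the smallest ones
that contain `v`. -/
def HasExcess (r : V → V → Prop) (t : Set V) (v : V) (e : ℕ) : Prop :=
  ∃ m : ℕ, IsLeast {k | ∃ S : Finset V, Covers r t S ∧ v ∈ S ∧ S.card = k} (m + 1) ∧
    IsLeast {k | ∃ S : Finset V, Covers r t S ∧ v ∉ S ∧ S.card = k} (m + e)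

open Classical in
theorem Covers.filter (h : Covers r t S) : Covers r t (S.filter (· ∈ t)) := by
  intro x hx y hy hxy hne
  have := h x hx y hy hxy hne
  simp only [Finset.mem_filter]
  tauto

theorem Covers.mono_set (h : Covers r t S) (hab : a ⊆ t) : Covers r a S :=
  fun x hx y hy => h x (hab hx) y (hab hy)

open Classical in
-- By `hcross` the only possible edge between the two parts is the one from `v` to `n`, and `h`
-- covers it. Both coverings are first cut down to their own part, so that `Sb` cannot bring in `v`.
theorem exists_covers_union (hdisj : Disjoint a b) (hv : v ∈ a) (hn : n ∈ b)
    (hcross : ∀ x ∈ a, ∀ y ∈ b, r x y ∨ r y x → x = v ∧ y = n) {Sa Sb : Finset V}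
    (hSa : Covers r a Sa) (hSb : Covers r b Sb) (h : v ∈ Sa ∨ n ∈ Sb) :
    ∃ S : Finset V, Covers r (a ∪ b) S ∧ (v ∈ S ↔ v ∈ Sa) ∧ S.card ≤ Sa.card + Sb.card := by
  refine ⟨Sa.filter (· ∈ a) ∪ Sb.filter (· ∈ b), ?_, ?_, ?_⟩
  · intro x hx y hy hxy hne
    simp only [Finset.mem_union, Finset.mem_filter]
    rcases hx with hx | hx <;> rcases hy with hy | hy
    · have := hSa x hx y hy hxy hne; tauto
    · obtain ⟨rfl, rfl⟩ := hcross x hx y hy (.inl hxy); tauto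
    · obtain ⟨rfl, rfl⟩ := hcross y hy x hx (.inr hxy); tauto
    · have := hSb x hx y hy hxy hne; tauto
  · have := Set.disjoint_left.1 hdisj hv
    simp [hv, this]
  · exact (Finset.card_union_le _ _).trans
      (add_le_add (Finset.card_filter_le _ _) (Finset.card_filter_le _ _))

open Classical in
theorem card_filter_add_card_filter_le (hdisj : Disjoint a b) (S : Finset V) :
    (S.filter (· ∈ a)).card + (S.filter (· ∈ b)).card ≤ S.card := by
  rw [← Finset.card_union_of_disjoint]
  · exact Finset.card_le_card
      (Finset.union_subset (Finset.filter_subset _ _) (Finset.filter_subset _ _))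
  · rw [Finset.disjoint_filter]
    exact fun x _ hx => Set.disjoint_left.1 hdisj hx

/-- Without edges the empty covering is best, and insisting on `v` costs one element. This is the
start of every induction on the excess. -/
theorem hasExcess_singleton (r : V → V → Prop) (v : V) : HasExcess r {v} v 0 := by
  have hc : ∀ S, Covers r {v} S := by
    rintro S x rfl y rfl _ h
    exact absurd rfl h
  refine ⟨0, ⟨⟨{v}, hc _, by simp, by simp⟩, ?_⟩, ⟨⟨∅, hc _, by simp, by simp⟩, ?_⟩⟩
  · rintro k ⟨S, -, hv, rfl⟩
    have := Finset.card_pos.2 ⟨v, hv⟩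
    omega
  · intro k _
    omega

open Classical in
/-- Joining two rooted graphs by an edge between their roots. -/
theorem HasExcess.union (hdisj : Disjoint a b) (hv : v ∈ a) (hn : n ∈ b) (hvn : r v n ∨ r n v)
    (hcross : ∀ x ∈ a, ∀ y ∈ b, r x y ∨ r y x → x = v ∧ y = n)
    (ha : HasExcess r a v e) (hb : HasExcess r b n e') :
    HasExcess r (a ∪ b) v (e + if e' = 0 then 1 else 0) := by
  obtain ⟨m, ⟨⟨A, hA, hvA, hAc⟩, hA'⟩, ⟨⟨B, hB, hvB, hBc⟩, hB'⟩⟩ := ha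
  obtain ⟨k, ⟨⟨C, hC, hnC, hCc⟩, hC'⟩, ⟨⟨D, hD, hnD, hDc⟩, hD'⟩⟩ := hb
  have hne : v ≠ n := fun h => Set.disjoint_left.1 hdisj hv (h ▸ hn)
  -- Lower bounds, from the traces of a covering on the two parts. A covering that avoids `v` has to
  -- contain `n`, because of the joining edge.
  have split : ∀ S : Finset V, Covers r (a ∪ b) S →
      (v ∈ S → m + 1 + (k + if e' = 0 then 0 else 1) ≤ S.card) ∧
      (v ∉ S → m + e + (k + 1) ≤ S.card) := by
    intro S hS
    have h1 := card_filter_add_card_filter_le hdisj S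
    have h2 : Covers r a (S.filter (· ∈ a)) := (hS.mono_set subset_union_left).filter
    have h3 : Covers r b (S.filter (· ∈ b)) := (hS.mono_set subset_union_right).filter
    constructor
    · intro hvS
      have h4 := hA' ⟨_, h2, by simp [hvS, hv], rfl⟩
      by_cases hnS : n ∈ S
      · have h5 := hC' ⟨_, h3, by simp [hnS, hn], rfl⟩
        split_ifs <;> omega
      · have h5 := hD' ⟨_, h3, by simp [hnS], rfl⟩
        split_ifs <;> omega
    · intro hvS
      have hnS : n ∈ S := by
        rcases hvn with h | h
        · exact (hS v (.inl hv) n (.inr hn) h hne).resolve_left hvS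
        · exact (hS n (.inr hn) v (.inl hv) h hne.symm).resolve_right hvS
      have h4 := hB' ⟨_, h2, by simp [hvS], rfl⟩
      have h5 := hC' ⟨_, h3, by simp [hnS, hn], rfl⟩
      omega
  -- If `v` is taken, the part `b` costs k + min(1, e'); if not, `n` is forced and it costs k + 1.
  -- The difference 1 - min(1, e') is the gain in excess.
  refine ⟨m + (k + if e' = 0 then 0 else 1), ⟨?_, ?_⟩, ⟨?_, ?_⟩⟩
  · by_cases h0 : e' = 0
    · obtain ⟨S, hS, hvS, hc⟩ := exists_covers_union hdisj hv hn hcross hA hD (.inl hvA)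
      have := (split S hS).1 (hvS.2 hvA)
      refine ⟨S, hS, hvS.2 hvA, ?_⟩
      simp only [h0, if_true] at *
      omega
    · obtain ⟨S, hS, hvS, hc⟩ := exists_covers_union hdisj hv hn hcross hA hC (.inl hvA)
      have := (split S hS).1 (hvS.2 hvA)
      refine ⟨S, hS, hvS.2 hvA, ?_⟩
      simp only [h0, if_false] at *
      omega
  · rintro _ ⟨S, hS, hvS, rfl⟩
    have := (split S hS).1 hvS
    omega
  · obtain ⟨S, hS, hvS, hc⟩ := exists_covers_union hdisj hv hn hcross hB hC (.inr hnC)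
    have hvS' : v ∉ S := fun h => hvB (hvS.1 h)
    have := (split S hS).2 hvS'
    refine ⟨S, hS, hvS', ?_⟩
    split_ifs <;> omega
  · rintro _ ⟨S, hS, hvS, rfl⟩
    have := (split S hS).2 hvS
    split_ifs <;> omega

open Classical in
/-- Joining the root of a rooted graph to the roots of finitely many others. -/
theorem HasExcess.biUnion {ι : Type*} {I : Finset ι} {s : ι → Set V} {n : ι → V} {f : ι → ℕ}
    (hva : v ∈ a) (ha : HasExcess r a v e) (hs : ∀ i ∈ I, HasExcess r (s i) (n i) (f i))
    (hn : ∀ i ∈ I, n i ∈ s i) (hr : ∀ i ∈ I, r v (n i) ∨ r (n i) v)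
    (hda : ∀ i ∈ I, Disjoint a (s i)) (hd : ∀ i ∈ I, ∀ j ∈ I, i ≠ j → Disjoint (s i) (s j))
    (hca : ∀ i ∈ I, ∀ x ∈ a, ∀ y ∈ s i, r x y ∨ r y x → x = v ∧ y = n i)
    (hc : ∀ i ∈ I, ∀ j ∈ I, i ≠ j → ∀ x ∈ s i, ∀ y ∈ s j, ¬ r x y) :
    HasExcess r (a ∪ ⋃ i ∈ I, s i) v (e + (I.filter (fun i => f i = 0)).card) := by
  induction I using Finset.induction_on with
  | empty => simpa using ha
  | insert i J hi ih =>
    have key := ih (fun j hj => hs j (Finset.mem_insert_of_mem hj))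
      (fun j hj => hn j (Finset.mem_insert_of_mem hj))
      (fun j hj => hr j (Finset.mem_insert_of_mem hj))
      (fun j hj => hda j (Finset.mem_insert_of_mem hj))
      (fun j hj k hk => hd j (Finset.mem_insert_of_mem hj) k (Finset.mem_insert_of_mem hk))
      (fun j hj => hca j (Finset.mem_insert_of_mem hj))
      (fun j hj k hk => hc j (Finset.mem_insert_of_mem hj) k (Finset.mem_insert_of_mem hk))
    have hiI := Finset.mem_insert_self i J
    have hne : ∀ j ∈ J, j ≠ i := fun j hj h => hi (h ▸ hj)
    have hstep := key.union (b := s i) (n := n i) (e' := f i) ?_ (.inl hva) (hn i hiI) (hr i hiI)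
      ?_ (hs i hiI)
    · rw [Finset.set_biUnion_insert, Set.union_comm (s i), ← Set.union_assoc,
        Finset.filter_insert]
      convert hstep using 1
      split_ifs
      · rw [Finset.card_insert_of_notMem (by simp [hi]), add_assoc]
      · rfl
    · rw [Set.disjoint_union_left, Set.disjoint_iUnion₂_left]
      exact ⟨hda i hiI, fun j hj => hd j (Finset.mem_insert_of_mem hj) i hiI (hne j hj)⟩
    · rintro x (hx | hx) y hy hxy
      · exact hca i hiI x hx y hy hxy
      · obtain ⟨j, hj, hx⟩ := Set.mem_iUnion₂.1 hx
        have hj' := Finset.mem_insert_of_mem (a := j) (b := i) hj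
        rcases hxy with h | h
        · exact absurd h (hc j hj' i hiI (hne j hj) x hx y hy)
        · exact absurd h (hc i hiI j hj' (hne j hj).symm y hy x hx)

end Cover

/-! ### The colour of a vertex in terms of its excess -/

/-- The colour that belongs to an excess. -/
def colourOf : ℕ → Colour
  | 0 => Colour.red
  | 1 => Colour.orange
  | _ + 2 => Colour.green

theorem isVertexCover_graphOn {t : Set Vertex} {S : Finset Vertex} :
    (graphOn t).IsVertexCover (S : Set Vertex) ↔ Covers (fun x y => parent x = y) t S := by
  simp only [SimpleGraph.IsVertexCover, graphOn, SimpleGraph.fromRel_adj, Covers, Finset.mem_coe]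
  constructor
  · intro h x hx y hy hxy hne
    exact h ⟨hne, .inl ⟨hx, hy, hxy⟩⟩
  · rintro h x y ⟨hne, ⟨hx, hy, hxy⟩ | ⟨hx, hy, hxy⟩⟩
    · exact h x hx y hy hxy hne
    · exact (h y hx x hy hxy hne.symm).symm

/-- The minimal size of a covering is the smaller of m + 1 and m + e; the colour records which of
the two classes attain it. -/
theorem colourIn_eq_colourOf {t : Set Vertex} {v : Vertex} {e : ℕ}
    (h : HasExcess (fun x y => parent x = y) t v e) : colourIn t v = colourOf e := by
  classical
  obtain ⟨m, ⟨⟨A, hA, hvA, hAc⟩, hA'⟩, ⟨⟨B, hB, hvB, hBc⟩, hB'⟩⟩ := h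
  have low : ∀ S, Covers (fun x y => parent x = y) t S → m + min 1 e ≤ S.card := by
    intro S hS
    by_cases hv : v ∈ S
    · have := hA' ⟨S, hS, hv, rfl⟩; omega
    · have := hB' ⟨S, hS, hv, rfl⟩; omega
  have hsm : ∀ S, Covers (fun x y => parent x = y) t S → S.card ≤ m + min 1 e →
      IsSmallestCovering (graphOn t) S := fun S hS hc =>
    ⟨isVertexCover_graphOn.2 hS, fun S' hS' => hc.trans (low S' (isVertexCover_graphOn.1 hS'))⟩
  unfold colourIn tricolour
  match e with
  | 0 =>
    rw [if_neg, if_pos]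
    · rfl
    · intro S hS hv
      have h1 := hA' ⟨S, isVertexCover_graphOn.1 hS.1, hv, rfl⟩
      have h2 := hS.2 B (isVertexCover_graphOn.2 hB)
      omega
    · intro h
      exact hvB (h B (hsm B hB (by omega)))
  | 1 =>
    rw [if_neg, if_neg]
    · rfl
    · intro h
      exact h A (hsm A hA (by omega)) hvA
    · intro h
      exact hvB (h B (hsm B hB (by omega)))
  | e + 2 =>
    rw [if_pos]
    · rfl
    · intro S hS
      by_contra hv
      have h1 := hB' ⟨S, isVertexCover_graphOn.1 hS.1, hv, rfl⟩
      have h2 := hS.2 A (isVertexCover_graphOn.2 hA)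
      omega

/-! ### Plane trees of finite height -/

/-- The numbers of children in the subtree that is rooted at the `i`-th child of the root. -/
def sub (ξ : List ℕ → ℕ) (i : ℕ) : List ℕ → ℕ := fun l => ξ (i :: l)

/-- The plane tree has at most `n` generations. -/
def HeightLT : ℕ → (List ℕ → ℕ) → Prop
  | 0, _ => False
  | n + 1, ξ => ∀ i < ξ [], HeightLT n (sub ξ i)

/-- The plane tree has finitely many generations. -/
def FiniteHeight (ξ : List ℕ → ℕ) : Prop := ∃ n, HeightLT n ξ

/-- In plane trees with at most `n` generations: the root is red. -/
def RedUpTo : ℕ → (List ℕ → ℕ) → Prop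
  | 0, _ => False
  | n + 1, ξ => ∀ i < ξ [], ¬ RedUpTo n (sub ξ i)

/-- The plane tree has finitely many generations and a red root. -/
def RootRed (ξ : List ℕ → ℕ) : Prop := ∃ n, HeightLT n ξ ∧ RedUpTo n ξ

open Classical in
/-- The number of children of the root that are red in their subtrees. -/
noncomputable def redCount (ξ : List ℕ → ℕ) : ℕ :=
  ((Finset.range (ξ [])).filter (fun i => RootRed (sub ξ i))).card

theorem HeightLT.mono {n m : ℕ} {ξ : List ℕ → ℕ} (h : HeightLT n ξ) (hnm : n ≤ m) :
    HeightLT m ξ := by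
  induction n generalizing m ξ with
  | zero => exact h.elim
  | succ n ih =>
    obtain ⟨m, rfl⟩ : ∃ k, m = k + 1 := ⟨m - 1, by omega⟩
    exact fun i hi => ih (h i hi) (by omega)

/-- The value `False` of `RedUpTo` at 0 is only a default. Once the bound reaches the height, the
recursion stops at leaves before that default is used, so the bound is irrelevant. -/
theorem HeightLT.redUpTo_iff {n m : ℕ} {ξ : List ℕ → ℕ} (h : HeightLT n ξ) (hnm : n ≤ m) :
    RedUpTo m ξ ↔ RedUpTo n ξ := by
  induction n generalizing m ξ with
  | zero => exact h.elim
  | succ n ih =>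
    obtain ⟨m, rfl⟩ : ∃ k, m = k + 1 := ⟨m - 1, by omega⟩
    exact forall₂_congr fun i hi => not_congr (ih (h i hi) (by omega))

theorem HeightLT.rootRed_iff {n : ℕ} {ξ : List ℕ → ℕ} (h : HeightLT n ξ) :
    RootRed ξ ↔ RedUpTo n ξ := by
  refine ⟨?_, fun hr => ⟨n, h, hr⟩⟩
  rintro ⟨m, hm, hr⟩
  rcases le_total n m with hnm | hnm
  · exact (h.redUpTo_iff hnm).1 hr
  · exact (hm.redUpTo_iff hnm).2 hr

/-- The root has finitely many children, so the heights of their subtrees have a maximum. -/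
theorem finiteHeight_iff {ξ : List ℕ → ℕ} : FiniteHeight ξ ↔ ∀ i < ξ [], FiniteHeight (sub ξ i) := by
  constructor
  · rintro ⟨n, hn⟩ i hi
    cases n with
    | zero => exact hn.elim
    | succ n => exact ⟨n, hn i hi⟩
  · intro h
    choose! f hf using h
    refine ⟨(Finset.range (ξ [])).sup f + 1, fun i hi => (hf i hi).mono ?_⟩
    exact Finset.le_sup (f := f) (Finset.mem_range.2 hi)

theorem FiniteHeight.rootRed_iff {ξ : List ℕ → ℕ} (h : FiniteHeight ξ) :
    RootRed ξ ↔ ∀ i < ξ [], ¬ RootRed (sub ξ i) := by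
  obtain ⟨n, hn⟩ := h
  cases n with
  | zero => exact hn.elim
  | succ n =>
    rw [hn.rootRed_iff]
    exact forall₂_congr fun i hi => not_congr (hn i hi).rootRed_iff.symm

theorem FiniteHeight.rootRed_iff_redCount {ξ : List ℕ → ℕ} (h : FiniteHeight ξ) :
    RootRed ξ ↔ redCount ξ = 0 := by
  classical
  rw [h.rootRed_iff, redCount, Finset.card_eq_zero, Finset.filter_eq_empty_iff]
  simp

theorem inPlaneTree_append {ξ : List ℕ → ℕ} {a l : List ℕ} :
    InPlaneTree ξ (a ++ l) ↔ InPlaneTree ξ a ∧ InPlaneTree (fun b => ξ (a ++ b)) l := by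
  induction a generalizing ξ with
  | nil => simp [InPlaneTree]
  | cons i a ih => simp [InPlaneTree, ih, and_assoc]

/-! ### Subtrees of the ambient tree -/

theorem parent_bush_append (b : Base) (a : List ℕ) (i : ℕ) :
    parent (Vertex.bush b (a ++ [i])) = Vertex.bush b a := by
  cases a with
  | nil => simp [parent]
  | cons c l =>
    simp only [List.cons_append, parent]
    rw [← List.cons_append, List.dropLast_concat]

theorem parent_eq_bush {x : Vertex} {b : Base} {a : List ℕ} (h : parent x = Vertex.bush b a) :
    ∃ i, x = Vertex.bush b (a ++ [i]) := by
  cases x with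
  | spine k => simp [parent, u] at h
  | bush b' l =>
    rcases List.eq_nil_or_concat l with rfl | ⟨l', i, rfl⟩
    · rcases b' with _ | ⟨k, s, i⟩ <;> simp [parent, u] at h
    · rw [List.concat_eq_append, parent_bush_append] at h
      cases h
      exact ⟨i, by simp⟩

theorem descends_bush {x : Vertex} {b : Base} {a : List ℕ} :
    Descends x (Vertex.bush b a) ↔ ∃ l, x = Vertex.bush b (a ++ l) := by
  constructor
  · rintro ⟨n, hn⟩
    induction n generalizing x with
    | zero => exact ⟨[], by simpa using hn⟩
    | succ n ih =>
      obtain ⟨l, hl⟩ := ih (x := parent x) (by simpa using hn)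
      obtain ⟨i, rfl⟩ := parent_eq_bush hl
      exact ⟨l ++ [i], by simp⟩
  · rintro ⟨l, rfl⟩
    induction l using List.reverseRecOn with
    | nil => exact ⟨0, by simp⟩
    | append_singleton l i ih =>
      obtain ⟨n, hn⟩ := ih
      refine ⟨n + 1, ?_⟩
      rw [Function.iterate_succ_apply, ← List.append_assoc, parent_bush_append, hn]

/-- The copy of the plane tree of `ξ` that is rooted at `bush b a`. -/
def treeAt (b : Base) (a : List ℕ) (ξ : List ℕ → ℕ) : Set Vertex :=
  {x | ∃ l, x = Vertex.bush b (a ++ l) ∧ InPlaneTree ξ l}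

theorem mem_treeAt_self (b : Base) (a : List ℕ) (ξ : List ℕ → ℕ) :
    Vertex.bush b a ∈ treeAt b a ξ := ⟨[], by simp, trivial⟩

theorem treeAt_eq (b : Base) (a : List ℕ) (ξ : List ℕ → ℕ) :
    treeAt b a ξ = {Vertex.bush b a} ∪
      ⋃ i ∈ Finset.range (ξ []), treeAt b (a ++ [i]) (sub ξ i) := by
  ext x
  simp only [treeAt, Set.mem_union, Set.mem_singleton_iff, Set.mem_iUnion, Finset.mem_range,
    Set.mem_ofPred_eq, exists_prop]
  constructor
  · rintro ⟨l, rfl, hl⟩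
    cases l with
    | nil => simp
    | cons i l => exact .inr ⟨i, hl.1, l, by simp, hl.2⟩
  · rintro (rfl | ⟨i, hi, l, rfl, hl⟩)
    · exact ⟨[], by simp, trivial⟩
    · exact ⟨i :: l, by simp, hi, hl⟩

/-- The root alone has excess 0, and each child with excess 0, that is, each red child, adds one.
The induction on the height yields the colours of all subtrees together. -/
theorem hasExcess_treeAt {ξ : List ℕ → ℕ} (h : FiniteHeight ξ) (b : Base) (a : List ℕ) :
    HasExcess (fun x y => parent x = y) (treeAt b a ξ) (Vertex.bush b a) (redCount ξ) := by
  classical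
  obtain ⟨n, hn⟩ := h
  induction n generalizing ξ a with
  | zero => exact hn.elim
  | succ n ih =>
    have hcount : redCount ξ = 0 + ((Finset.range (ξ [])).filter
        (fun i => redCount (sub ξ i) = 0)).card := by
      rw [zero_add, redCount]
      congr 1
      refine Finset.filter_congr fun i hi => ?_
      exact FiniteHeight.rootRed_iff_redCount ⟨n, hn i (Finset.mem_range.1 hi)⟩
    rw [treeAt_eq, hcount]
    refine HasExcess.biUnion (n := fun i => Vertex.bush b (a ++ [i])) (Set.mem_singleton _)
      (hasExcess_singleton _ _) ?_ ?_ ?_ ?_ ?_ ?_ ?_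
    · exact fun i hi => ih (a ++ [i]) (hn i (Finset.mem_range.1 hi))
    · exact fun i _ => mem_treeAt_self _ _ _
    · exact fun i _ => .inr (parent_bush_append _ _ _)
    · rintro i -
      rw [Set.disjoint_singleton_left]
      rintro ⟨l, hl, -⟩
      simp at hl
    · intro i _ j _ hij
      rw [Set.disjoint_left]
      rintro _ ⟨l, rfl, -⟩ ⟨l', hl', -⟩
      simp at hl'
      exact hij hl'.1
    · rintro i - _ rfl y ⟨l, rfl, -⟩ (h | h)
      · obtain ⟨j, hj⟩ := parent_eq_bush h
        have := congrArg List.length (Vertex.bush.inj hj).2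
        simp at this
      · obtain ⟨j, hj⟩ := parent_eq_bush h
        have := (Vertex.bush.inj hj).2
        simp at this
        simp [this]
    · rintro i - j - hij _ ⟨l, rfl, -⟩ y ⟨l', rfl, -⟩ h
      obtain ⟨c, hc⟩ := parent_eq_bush h
      have := (Vertex.bush.inj hc).2
      simp at this
      exact hij this.1

/-! ### Levels along the spine -/

/-- The index of the first spine vertex among the ancestors of a vertex. -/
def level : Vertex → ℕ
  | Vertex.spine k => k + 1
  | Vertex.bush none _ => 0
  | Vertex.bush (some (k, _)) _ => k + 1

@[simp] theorem level_u (k : ℕ) : level (u k) = k := by cases k <;> rfl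

theorem parent_u (k : ℕ) : parent (u k) = u (k + 1) := by cases k <;> rfl

theorem level_parent {x : Vertex} (h : x ≠ u (level x)) : level (parent x) = level x := by
  cases x with
  | spine k => exact absurd rfl h
  | bush b l =>
    rcases List.eq_nil_or_concat l with rfl | ⟨l', i, rfl⟩
    · rcases b with _ | ⟨k, s, i⟩
      · exact absurd rfl h
      · rfl
    · rw [List.concat_eq_append, parent_bush_append]
      rcases b with _ | ⟨k, s, i⟩ <;> rfl

theorem level_le_level_parent (x : Vertex) : level x ≤ level (parent x) := by
  by_cases h : x = u (level x)
  · rw [h, parent_u]; simp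
  · rw [level_parent h]

theorem descends_trans {x y z : Vertex} (h : Descends x y) (h' : Descends y z) : Descends x z := by
  obtain ⟨n, rfl⟩ := h
  obtain ⟨m, rfl⟩ := h'
  exact ⟨m + n, Function.iterate_add_apply _ _ _ _⟩

theorem descends_parent (x : Vertex) : Descends x (parent x) := ⟨1, rfl⟩

theorem descends_u_add (k n : ℕ) : Descends (u k) (u (k + n)) := by
  induction n with
  | zero => exact ⟨0, rfl⟩
  | succ n ih => exact descends_trans ih ⟨1, parent_u _⟩

theorem descends_u_level (x : Vertex) : Descends x (u (level x)) := by
  cases x with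
  | spine k => exact ⟨0, rfl⟩
  | bush b l =>
    have h : Descends (Vertex.bush b l) (Vertex.bush b []) := descends_bush.2 ⟨l, rfl⟩
    rcases b with _ | ⟨k, s, i⟩
    · exact h
    · exact descends_trans h (descends_parent _)

/-- This turns the subtrees below spine vertices into sublevel sets, so that they can be cut into
the slices of constant level. -/
theorem descends_u {x : Vertex} {k : ℕ} : Descends x (u k) ↔ level x ≤ k := by
  constructor
  · rintro ⟨n, hn⟩
    induction n generalizing x with
    | zero => simp [show x = u k from hn]
    | succ n ih => exact (level_le_level_parent x).trans (ih hn)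
  · intro h
    obtain ⟨n, rfl⟩ := Nat.exists_eq_add_of_le h
    exact descends_trans (descends_u_level x) (descends_u_add _ _)

theorem below_u (t : Set Vertex) (k : ℕ) : below t (u k) = {x ∈ t | level x ≤ k} := by
  simp only [below, descends_u]

/-! ### The tree with the whole spine -/

/-- The numbers of children in the tree that is attached at `b`. -/
def attached (ω : Sample) (b : Base) : List ℕ → ℕ := fun l => ω.1 (b, l)

theorem u_mem_treeOne (ω : Sample) (k : ℕ) : u k ∈ treeOne ω := by
  cases k with
  | zero => exact ⟨trivial, trivial⟩
  | succ k => trivial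

theorem parent_mem_treeOne {ω : Sample} {x : Vertex} (h : x ∈ treeOne ω) :
    parent x ∈ treeOne ω := by
  cases x with
  | spine k => exact u_mem_treeOne _ (k + 2)
  | bush b l =>
    rcases List.eq_nil_or_concat l with rfl | ⟨l', i, rfl⟩
    · rcases b with _ | ⟨k, s, i⟩
      · exact u_mem_treeOne _ 1
      · exact u_mem_treeOne _ (k + 1)
    · rw [List.concat_eq_append] at *
      rw [parent_bush_append]
      exact ⟨h.1, (inPlaneTree_append.1 h.2).1⟩

theorem below_treeOne_bush {ω : Sample} {b : Base} {a : List ℕ}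
    (h : Vertex.bush b a ∈ treeOne ω) :
    below (treeOne ω) (Vertex.bush b a) = treeAt b a (fun l => attached ω b (a ++ l)) := by
  ext x
  simp only [below, descends_bush, treeAt, Set.mem_ofPred_eq]
  constructor
  · rintro ⟨hx, l, rfl⟩
    exact ⟨l, rfl, (inPlaneTree_append.1 hx.2).2⟩
  · rintro ⟨l, rfl, hl⟩
    exact ⟨⟨h.1, inPlaneTree_append.2 ⟨h.2, hl⟩⟩, l, rfl⟩

theorem finite_basePresent {s : ℕ → ℕ∞ × ℕ∞} {k : ℕ} (h : ¬ InfiniteAt s k) :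
    {p : Bool × ℕ | BasePresent s (some (k, p))}.Finite := by
  simp only [InfiniteAt, ENat.add_eq_top, not_or] at h
  obtain ⟨l, hl⟩ := ENat.ne_top_iff_exists.1 h.1
  obtain ⟨r, hr⟩ := ENat.ne_top_iff_exists.1 h.2
  refine ((Set.finite_univ (α := Bool)).prod (Set.finite_Iio (max l r))).subset ?_
  rintro ⟨_ | _, i⟩ hp
  · change (i : ℕ∞) < (s k).1 at hp
    rw [← hl, Nat.cast_lt] at hp
    exact ⟨trivial, lt_max_of_lt_left hp⟩
  · change (i : ℕ∞) < (s k).2 at hp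
    rw [← hr, Nat.cast_lt] at hp
    exact ⟨trivial, lt_max_of_lt_right hp⟩

theorem infinite_basePresent {s : ℕ → ℕ∞ × ℕ∞} {k : ℕ} (h : InfiniteAt s k) :
    {p : Bool × ℕ | BasePresent s (some (k, p))}.Infinite := by
  simp only [InfiniteAt, ENat.add_eq_top] at h
  rcases h with h | h
  · refine (Set.infinite_range_of_injective (Prod.mk_right_injective false)).mono ?_
    rintro _ ⟨i, rfl⟩
    change (i : ℕ∞) < (s k).1
    simp [h]
  · refine (Set.infinite_range_of_injective (Prod.mk_right_injective true)).mono ?_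
    rintro _ ⟨i, rfl⟩
    change (i : ℕ∞) < (s k).2
    simp [h]

/-- The places of the red children of `u_{k+1}` other than `u_k`. -/
def redSides (ω : Sample) (k : ℕ) : Set (Bool × ℕ) :=
  {p | BasePresent ω.2 (some (k, p)) ∧ RootRed (attached ω (some (k, p)))}

/-- The number of red children of `u_k` other than `u_{k-1}`. -/
noncomputable def levelExcess (ω : Sample) : ℕ → ℕ
  | 0 => redCount (attached ω none)
  | k + 1 => (redSides ω k).ncard

theorem level_zero_eq (ω : Sample) :
    {x ∈ treeOne ω | level x = 0} = treeAt none [] (attached ω none) := by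
  ext x
  constructor
  · rintro ⟨hx, h⟩
    rcases x with k | ⟨_ | ⟨k, p⟩, l⟩
    · simp [level] at h
    · exact ⟨l, by simp, hx.2⟩
    · simp [level] at h
  · rintro ⟨l, rfl, hl⟩
    exact ⟨⟨trivial, hl⟩, rfl⟩

theorem level_succ_eq (ω : Sample) (k : ℕ) :
    {x ∈ treeOne ω | level x = k + 1} = {Vertex.spine k} ∪
      ⋃ p ∈ {p : Bool × ℕ | BasePresent ω.2 (some (k, p))},
        treeAt (some (k, p)) [] (attached ω (some (k, p))) := by
  ext x
  simp only [Set.mem_union, Set.mem_singleton_iff, Set.mem_iUnion, Set.mem_ofPred_eq, exists_prop]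
  constructor
  · rintro ⟨hx, h⟩
    rcases x with j | ⟨_ | ⟨j, p⟩, l⟩
    · simp only [level, add_left_inj] at h
      exact .inl (by rw [h])
    · simp [level] at h
    · simp only [level, add_left_inj] at h
      subst h
      exact .inr ⟨p, hx.1, l, by simp, hx.2⟩
  · rintro (rfl | ⟨p, hp, l, rfl, hl⟩)
    · exact ⟨trivial, rfl⟩
    · exact ⟨⟨hp, hl⟩, rfl⟩

/-- A slice consists of u_j and its side trees, without u_{j-1}, so its excess counts red side
children. Finitely many siblings are needed because the trees are attached one at a time. -/
theorem hasExcess_level {ω : Sample} (hω : ∀ b, FiniteHeight (attached ω b)) (j : ℕ)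
    (hj : ∀ k, k + 1 = j → ¬ InfiniteAt ω.2 k) :
    HasExcess (fun x y => parent x = y) {x ∈ treeOne ω | level x = j} (u j) (levelExcess ω j) := by
  classical
  cases j with
  | zero =>
    rw [level_zero_eq]
    exact hasExcess_treeAt (hω none) none []
  | succ k =>
    have hfin := finite_basePresent (hj k rfl)
    have hcount : levelExcess ω (k + 1) = 0 + (hfin.toFinset.filter
        (fun p => redCount (attached ω (some (k, p))) = 0)).card := by
      rw [zero_add, levelExcess, ← Set.ncard_coe_finset]
      congr 1
      ext p
      simp [redSides, (hω _).rootRed_iff_redCount]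
    rw [level_succ_eq, hcount]
    have := HasExcess.biUnion (r := fun x y => parent x = y) (I := hfin.toFinset)
      (a := {Vertex.spine k}) (v := Vertex.spine k)
      (s := fun p => treeAt (some (k, p)) [] (attached ω (some (k, p))))
      (n := fun p => Vertex.bush (some (k, p)) [])
      (f := fun p => redCount (attached ω (some (k, p)))) (Set.mem_singleton _)
      (hasExcess_singleton _ _) (fun p _ => hasExcess_treeAt (hω _) _ _)
      (fun p _ => mem_treeAt_self _ _ _) (fun p _ => .inr rfl) ?_ ?_ ?_ ?_
    · simpa [u] using this
    · rintro p -
      rw [Set.disjoint_singleton_left]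
      rintro ⟨l, hl, -⟩
      cases hl
    · intro p _ p' _ hpp
      rw [Set.disjoint_left]
      rintro _ ⟨l, rfl, -⟩ ⟨l', hl', -⟩
      cases hl'
      exact hpp rfl
    · rintro p - _ rfl y ⟨l, rfl, -⟩ (h | h)
      · simp [parent, u] at h
      · refine ⟨rfl, ?_⟩
        rcases List.eq_nil_or_concat l with rfl | ⟨l', i, rfl⟩
        · rfl
        · rw [List.concat_eq_append, ← List.append_assoc, parent_bush_append] at h
          cases h
    · rintro p - p' - hpp _ ⟨l, rfl, -⟩ y ⟨l', rfl, -⟩ h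
      obtain ⟨c, hc⟩ := parent_eq_bush h
      cases (Vertex.bush.inj hc).1
      exact hpp rfl

/-- Here the orientation is reversed: the parent u_{j+1}, with everything above it up to level `K`,
acts as one more child of u_j. -/
theorem HasExcess.level_union {ω : Sample} {j K e e' : ℕ} (hjK : j < K)
    (h : HasExcess (fun x y => parent x = y) {x ∈ treeOne ω | level x = j} (u j) e)
    (h' : HasExcess (fun x y => parent x = y)
      {x ∈ treeOne ω | j + 1 ≤ level x ∧ level x ≤ K} (u (j + 1)) e') :
    HasExcess (fun x y => parent x = y) {x ∈ treeOne ω | j ≤ level x ∧ level x ≤ K} (u j)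
      (e + if e' = 0 then 1 else 0) := by
  have := h.union (v := u j) ?_ ?_ ?_ (.inl (parent_u j)) ?_ h'
  · convert! this using 1
    ext x
    simp only [Set.mem_union, Set.mem_ofPred_eq, ← and_or_left]
    refine and_congr_right fun _ => ?_
    omega
  · rw [Set.disjoint_left]
    rintro x ⟨-, hx⟩ ⟨-, hx', -⟩
    omega
  · exact ⟨u_mem_treeOne _ _, level_u j⟩
  · exact ⟨u_mem_treeOne _ _, by simp, by simpa using hjK⟩
  · rintro x ⟨-, hx⟩ y ⟨-, hy, -⟩ (h | h)
    · by_cases hxu : x = u (level x)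
      · rw [hx] at hxu
        rw [hxu, parent_u] at h
        exact ⟨hxu, h.symm⟩
      · have := level_parent hxu
        rw [h] at this
        omega
    · have := level_le_level_parent y
      rw [h] at this
      omega

/-- The number of red neighbours of `u_0` in the subtree below `u_K`; `n` is the index of the first
spine vertex `u_{n+1}` that has a red child other than `u_n`. -/
theorem hasExcess_below {ω : Sample} (hω : ∀ b, FiniteHeight (attached ω b)) {n K : ℕ}
    (hfin : ∀ k < K, ¬ InfiniteAt ω.2 k) (hzero : ∀ k < n, levelExcess ω (k + 1) = 0)
    (hn : n = K ∨ n < K ∧ levelExcess ω (n + 1) ≠ 0) :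
    HasExcess (fun x y => parent x = y) (below (treeOne ω) (u K)) (u 0)
      (levelExcess ω 0 + if Odd n then 1 else 0) := by
  classical
  have hlev : ∀ j ≤ K, HasExcess (fun x y => parent x = y) {x ∈ treeOne ω | level x = j} (u j)
      (levelExcess ω j) := fun j hj => hasExcess_level hω j fun k hk => hfin k (by omega)
  have htop : HasExcess (fun x y => parent x = y) {x ∈ treeOne ω | K ≤ level x ∧ level x ≤ K} (u K)
      (levelExcess ω K) := by
    convert! hlev K le_rfl using 4
    omega
  -- Influence from above can only increase an excess, so a slice with positive excess keeps it
  -- whatever its ancestors do.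
  have hex : ∀ i j, i + j = K → ∃ e, HasExcess (fun x y => parent x = y)
      {x ∈ treeOne ω | j ≤ level x ∧ level x ≤ K} (u j) e ∧ levelExcess ω j ≤ e := by
    intro i
    induction i with
    | zero =>
      intro j hj
      obtain rfl : j = K := by omega
      exact ⟨_, htop, le_rfl⟩
    | succ i ih =>
      intro j hj
      obtain ⟨e, he, -⟩ := ih (j + 1) (by omega)
      exact ⟨_, (hlev j (by omega)).level_union (by omega) he, Nat.le_add_right _ _⟩
  have hnK : n ≤ K := by omega
  -- Induction downwards from u_n, with `i` the distance to u_n. Since the slices 1, …, n have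
  -- excess 0, the contribution from above alternates between 0 and 1.
  have key : ∀ i j, i + j = n → HasExcess (fun x y => parent x = y)
      {x ∈ treeOne ω | j ≤ level x ∧ level x ≤ K} (u j)
      (levelExcess ω j + if Odd i then 1 else 0) := by
    intro i
    induction i with
    | zero =>
      intro j hj
      obtain rfl : j = n := by omega
      -- Nothing is added at u_n: either it is the top vertex, or its parent has positive excess.
      rcases hn with rfl | ⟨hlt, hne⟩
      · simpa using htop
      · obtain ⟨e, he, hle⟩ := hex (K - (j + 1)) (j + 1) (by omega)
        have := (hlev j (by omega)).level_union hlt he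
        rwa [if_neg (by omega)] at this
    | succ i ih =>
      intro j hj
      have := (hlev j (by omega)).level_union (by omega) (ih (j + 1) (by omega))
      rw [hzero j (by omega), zero_add] at this
      convert! this using 2
      by_cases hi : Odd i <;> simp [hi, Nat.odd_add_one]
  rw [below_u]
  simpa using key n 0 rfl

/-! ### The colour of `u_0` in the infinite trees -/

/-- `u_{k+1}` has infinitely many children, or a red child other than `u_k`. -/
def Blocks (ω : Sample) (k : ℕ) : Prop := InfiniteAt ω.2 k ∨ (redSides ω k).Nonempty

theorem levelExcess_of_not_blocks {ω : Sample} {k : ℕ} (h : ¬ Blocks ω k) :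
    levelExcess ω (k + 1) = 0 := by
  simp only [Blocks, not_or, Set.not_nonempty_iff_eq_empty] at h
  simp [levelExcess, h.2]

theorem Blocks.levelExcess_ne {ω : Sample} {k : ℕ} (h : Blocks ω k) (hk : ¬ InfiniteAt ω.2 k) :
    levelExcess ω (k + 1) ≠ 0 := by
  have hfin : (redSides ω k).Finite := (finite_basePresent hk).subset fun p hp => hp.1
  exact (Set.ncard_pos hfin).2 (h.resolve_left hk) |>.ne'

open Classical in
/-- The colour of `u_0` in terms of the number of its red children and of the index of the first
spine vertex that blocks the influence of its ancestors. -/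
noncomputable def finalColour (ω : Sample) (n : ℕ) : Colour :=
  colourOf (redCount (attached ω none) + if Odd n then 1 else 0)

/-- The case n = K, in which nothing below u_K blocks, serves the second kind of tree, where the
blocking vertex u_{K+1} has been removed. -/
theorem colourIn_below {ω : Sample} (hω : ∀ b, FiniteHeight (attached ω b)) {n K : ℕ}
    (hfin : ∀ k < K, ¬ InfiniteAt ω.2 k) (hzero : ∀ k < n, ¬ Blocks ω k)
    (hn : n = K ∨ n < K ∧ Blocks ω n) :
    colourIn (below (treeOne ω) (u K)) (u 0) = finalColour ω n :=
  colourIn_eq_colourOf (hasExcess_below hω hfin (fun k hk => levelExcess_of_not_blocks (hzero k hk))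
    (hn.imp_right fun h => ⟨h.1, h.2.levelExcess_ne (hfin n h.1)⟩))

theorem hasLimitColour_iff {ω : Sample} (hω : ∀ b, FiniteHeight (attached ω b)) {n : ℕ}
    (hfin : ∀ k, ¬ InfiniteAt ω.2 k) (hzero : ∀ k < n, ¬ Blocks ω k) (hn : Blocks ω n)
    (c : Colour) : HasLimitColour (treeOne ω) (u 0) c ↔ finalColour ω n = c := by
  have h : ∀ᶠ K in atTop, colourIn (below (treeOne ω) (u K)) (u 0) = finalColour ω n := by
    filter_upwards [eventually_gt_atTop n] with K hK
    exact colourIn_below hω (fun k _ => hfin k) hzero (.inr ⟨hK, hn⟩)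
  constructor
  · rintro ⟨-, hc⟩
    obtain ⟨K, h1, h2⟩ := (h.and hc).exists
    exact h1.symm.trans h2
  · rintro rfl
    exact ⟨u_mem_treeOne ω 0, h⟩

theorem colourOf_eq_red {e : ℕ} : colourOf e = Colour.red ↔ e = 0 := by
  match e with
  | 0 => simp [colourOf]
  | 1 => simp [colourOf]
  | e + 2 => simp [colourOf]

theorem colourIn_treeAt_eq_red {ξ : List ℕ → ℕ} (h : FiniteHeight ξ) (b : Base) (a : List ℕ) :
    colourIn (treeAt b a ξ) (Vertex.bush b a) = Colour.red ↔ RootRed ξ := by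
  rw [colourIn_eq_colourOf (hasExcess_treeAt h b a), colourOf_eq_red, h.rootRed_iff_redCount]

theorem isRedSideChild_succ {ω : Sample} (hω : ∀ b, FiniteHeight (attached ω b)) {k : ℕ}
    {x : Vertex} : IsRedSideChild (treeOne ω) (k + 1) x ↔
      ∃ p ∈ redSides ω k, x = Vertex.bush (some (k, p)) [] := by
  constructor
  · rintro ⟨hx, hp, hne, hc⟩
    rcases x with j | ⟨b, l⟩
    · obtain rfl : j + 1 = k := Vertex.spine.inj hp
      exact absurd rfl (hne (j + 1) rfl)
    · rcases List.eq_nil_or_concat l with rfl | ⟨l', i, rfl⟩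
      · rcases b with _ | ⟨j, p⟩
        · obtain rfl : 0 = k := Vertex.spine.inj hp
          exact absurd rfl (hne 0 rfl)
        · obtain rfl : j = k := Vertex.spine.inj hp
          rw [below_treeOne_bush hx] at hc
          exact ⟨p, ⟨hx.1, (colourIn_treeAt_eq_red (hω _) _ _).1 hc⟩, rfl⟩
      · rw [List.concat_eq_append, parent_bush_append] at hp
        cases hp
  · rintro ⟨p, hp, rfl⟩
    have hx : Vertex.bush (some (k, p)) [] ∈ treeOne ω := ⟨hp.1, trivial⟩
    refine ⟨hx, rfl, ?_, ?_⟩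
    · rintro j hj h
      obtain rfl : j = k := by omega
      cases j <;> cases h
    · rw [below_treeOne_bush hx]
      exact (colourIn_treeAt_eq_red (hω _) _ _).2 hp.2

theorem isGood_succ {ω : Sample} (hω : ∀ b, FiniteHeight (attached ω b)) {k : ℕ} :
    IsGood (treeOne ω) (k + 1) ↔ (redSides ω k).Nontrivial := by
  simp only [IsGood, isRedSideChild_succ hω]
  constructor
  · rintro ⟨-, x, y, hxy, ⟨p, hp, rfl⟩, p', hp', rfl⟩
    exact ⟨p, hp, p', hp', fun h => hxy (by rw [h])⟩
  · rintro ⟨p, hp, p', hp', hpp⟩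
    refine ⟨u_mem_treeOne _ _, _, _, ?_, ⟨p, hp, rfl⟩, p', hp', rfl⟩
    intro h
    cases h
    exact hpp rfl

theorem two_le_redCount_of_isGood_zero {ω : Sample} (hω : ∀ b, FiniteHeight (attached ω b))
    (h : IsGood (treeOne ω) 0) : 2 ≤ redCount (attached ω none) := by
  classical
  have key : ∀ x, IsRedSideChild (treeOne ω) 0 x → ∃ i < attached ω none [],
      RootRed (sub (attached ω none) i) ∧ x = Vertex.bush none [i] := by
    rintro x ⟨hx, hp, -, hc⟩
    obtain ⟨i, rfl⟩ := parent_eq_bush hp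
    have hi : i < attached ω none [] := hx.2.1
    rw [below_treeOne_bush hx, colourIn_treeAt_eq_red] at hc
    · exact ⟨i, hi, hc, rfl⟩
    · exact finiteHeight_iff.1 (hω none) i hi
  obtain ⟨-, x, y, hxy, hx, hy⟩ := h
  obtain ⟨i, hi, hri, rfl⟩ := key x hx
  obtain ⟨j, hj, hrj, rfl⟩ := key y hy
  refine Finset.one_lt_card.2 ⟨i, by simp [hi, hri], j, by simp [hj, hrj], ?_⟩
  rintro rfl
  exact hxy rfl

/-- A good u_{k+1} has a red side child and therefore blocks, so n ≤ k. Hence the colour below any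
good vertex is already the final one. -/
theorem hasColourOne_iff {ω : Sample} (hω : ∀ b, FiniteHeight (attached ω b)) {n : ℕ}
    (hfin : ∀ k, ¬ InfiniteAt ω.2 k) (hzero : ∀ k < n, ¬ Blocks ω k) (hn : Blocks ω n)
    (hgood : ∃ᶠ k in atTop, (redSides ω k).Nontrivial)
    (c : Colour) : HasColourOne (treeOne ω) (u 0) c ↔ finalColour ω n = c := by
  have hinf : {k | IsGood (treeOne ω) k}.Infinite := by
    have := (Nat.frequently_atTop_iff_infinite.1 hgood).image
      (Function.Injective.injOn (add_left_injective 1))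
    refine this.mono ?_
    rintro _ ⟨k, hk, rfl⟩
    exact (isGood_succ hω).2 hk
  have hcol : ∀ k, IsGood (treeOne ω) k →
      colourIn (below (treeOne ω) (u k)) (u 0) = finalColour ω n := by
    intro k hk
    cases k with
    | zero =>
      -- If u_0 itself is good, its excess is at least 2 within its own tree, and the parity term
      -- cannot change the colour green.
      obtain ⟨m, hm⟩ := Nat.exists_eq_add_of_le (two_le_redCount_of_isGood_zero hω hk)
      rw [colourIn_below (n := 0) hω (by simp) (by simp) (.inl rfl), finalColour, finalColour, hm,
        add_comm 2 m, add_right_comm m 2, add_right_comm m 2]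
      rfl
    | succ k =>
      have hb : Blocks ω k := .inr ((isGood_succ hω).1 hk).nonempty
      have hnk : n ≤ k := by
        by_contra! h
        exact hzero k h hb
      exact colourIn_below hω (fun k _ => hfin k) hzero (.inr ⟨by omega, hn⟩)
  constructor
  · rintro ⟨-, -, hc⟩
    obtain ⟨k, hk⟩ := hinf.nonempty
    exact (hcol k hk).symm.trans (hc k hk (descends_u.2 (by simp)))
  · rintro rfl
    exact ⟨u_mem_treeOne ω 0, hinf, fun k hk _ => hcol k hk⟩

/-! ### Trees with vertices of infinite degree -/

theorem secondInfiniteAt_unique {s : ℕ → ℕ∞ × ℕ∞} {k k' : ℕ} (h : SecondInfiniteAt s k)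
    (h' : SecondInfiniteAt s k') : k = k' := by
  have key : ∀ {k k'}, SecondInfiniteAt s k → SecondInfiniteAt s k' → ¬ k < k' := by
    rintro k k' ⟨hk, f, ⟨hf, hf'⟩, -⟩ ⟨-, hu⟩ hlt
    have := hu.unique ⟨hlt, hk⟩ ⟨hf.trans hlt, hf'⟩
    omega
  exact le_antisymm (not_lt.1 (key h' h)) (not_lt.1 (key h h'))

theorem treeTwo_eq {ω : Sample} {k : ℕ} (h : SecondInfiniteAt ω.2 k) :
    treeTwo ω = {x ∈ treeOne ω | level x ≤ k} := by
  ext x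
  simp only [treeTwo, descends_u, Set.mem_ofPred_eq]
  refine and_congr_right fun _ => ⟨?_, fun hx => ⟨k, h, hx⟩⟩
  rintro ⟨k', hk', hx⟩
  rwa [secondInfiniteAt_unique h hk']

theorem graphOn_adj {t : Set Vertex} {x y : Vertex} :
    (graphOn t).Adj x y ↔ x ≠ y ∧ x ∈ t ∧ y ∈ t ∧ (parent x = y ∨ parent y = x) := by
  simp only [graphOn, SimpleGraph.fromRel_adj]
  tauto

theorem finite_children_bush (ω : Sample) (b : Base) (a : List ℕ) :
    {y ∈ treeOne ω | parent y = Vertex.bush b a}.Finite := by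
  refine ((Set.finite_Iio (attached ω b a)).image (fun i => Vertex.bush b (a ++ [i]))).subset ?_
  rintro y ⟨hy, hp⟩
  obtain ⟨i, rfl⟩ := parent_eq_bush hp
  refine ⟨i, ?_, rfl⟩
  simpa [attached] using (inPlaneTree_append.1 hy.2).2.1

theorem parent_eq_spine {y : Vertex} {k : ℕ} (h : parent y = Vertex.spine k) :
    y = u k ∨ ∃ p, y = Vertex.bush (some (k, p)) [] := by
  rcases y with j | ⟨b, l⟩
  · obtain rfl : j + 1 = k := Vertex.spine.inj h
    exact .inl rfl
  · rcases List.eq_nil_or_concat l with rfl | ⟨l', i, rfl⟩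
    · rcases b with _ | ⟨j, p⟩
      · obtain rfl : 0 = k := Vertex.spine.inj h
        exact .inl rfl
      · obtain rfl : j = k := Vertex.spine.inj h
        exact .inr ⟨p, rfl⟩
    · rw [List.concat_eq_append, parent_bush_append] at h
      cases h

theorem finite_children_spine {ω : Sample} {k : ℕ} (h : ¬ InfiniteAt ω.2 k) :
    {y ∈ treeOne ω | parent y = Vertex.spine k}.Finite := by
  refine (((finite_basePresent h).image (fun p => Vertex.bush (some (k, p)) [])).insert
    (u k)).subset ?_
  rintro y ⟨hy, hp⟩
  rcases parent_eq_spine hp with rfl | ⟨p, rfl⟩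
  · exact Set.mem_insert _ _
  · exact Set.mem_insert_of_mem _ ⟨p, hy.1, rfl⟩

/-- Keeping the levels up to `k` removes the second vertex u_{k+1} with infinitely many children and
keeps the first one, u_{f+1}, since f < k. -/
theorem infiniteDegree_eq {ω : Sample} {f k : ℕ} (hfk : f < k) (hf : InfiniteAt ω.2 f)
    (huniq : ∀ i < k, InfiniteAt ω.2 i → i = f) :
    infiniteDegree {x ∈ treeOne ω | level x ≤ k} = {Vertex.spine f} := by
  ext x
  simp only [infiniteDegree, graphOn_adj, Set.mem_singleton_iff, Set.mem_ofPred_eq]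
  constructor
  · rintro ⟨⟨hx, hxk⟩, hinf⟩
    by_contra hne
    have hfin : {y ∈ treeOne ω | parent y = x}.Finite := by
      rcases x with j | ⟨b, a⟩
      · have hjk : j < k := hxk
        exact finite_children_spine fun h => hne (by rw [huniq j hjk h])
      · exact finite_children_bush _ _ _
    refine hinf ((hfin.insert (parent x)).subset ?_)
    rintro y ⟨-, -, hy, h | h⟩
    · exact .inl h.symm
    · exact .inr ⟨hy.1, h⟩
  · rintro rfl
    have hmem : Vertex.spine f ∈ treeOne ω ∧ level (Vertex.spine f) ≤ k := ⟨trivial, hfk⟩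
    refine ⟨hmem, ?_⟩
    have hinj : Function.Injective (fun p : Bool × ℕ => Vertex.bush (some (f, p)) []) := by
      intro p p' h
      cases h
      rfl
    refine ((infinite_basePresent hf).image hinj.injOn).mono ?_
    rintro _ ⟨p, hp, rfl⟩
    exact ⟨by simp, hmem, ⟨⟨hp, trivial⟩, hfk⟩, .inr rfl⟩

theorem reachable_u {ω : Sample} {t : Set Vertex} {f : ℕ}
    (ht : ∀ x ∈ treeOne ω, level x ≤ f → x ∈ t) {x : Vertex} (hx : x ∈ treeOne ω)
    (hxf : level x ≤ f) : (graphOn t).Reachable x (u f) := by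
  obtain ⟨n, hn⟩ := descends_u.2 hxf
  induction n generalizing x with
  | zero => rw [show x = u f from hn]
  | succ n ih =>
    by_cases hxu : x = u f
    · rw [hxu]
    · have hpf : level (parent x) ≤ f := by
        by_cases h : x = u (level x)
        · have : level x ≠ f := fun h' => hxu (by rw [← h', ← h])
          rw [h, parent_u, level_u]
          omega
        · rwa [level_parent h]
      have hp := parent_mem_treeOne hx
      by_cases hxp : x = parent x
      · rw [hxp]; exact ih hp hpf hn
      · exact (SimpleGraph.Adj.reachable
          (graphOn_adj.2 ⟨hxp, ht x hx hxf, ht _ hp hpf, .inl rfl⟩)).trans (ih hp hpf hn)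

/-- Every path from a level at most `f` to a higher level passes through u_{f+1}, the vertex that is
cut out. -/
theorem component_eq {ω : Sample} {f k : ℕ} (hfk : f < k) :
    {x | (graphOn ({x ∈ treeOne ω | level x ≤ k} \ {Vertex.spine f})).Reachable (u 0) x} =
      below (treeOne ω) (u f) := by
  rw [below_u]
  set t := {x ∈ treeOne ω | level x ≤ k} \ {Vertex.spine f} with ht
  have hsub : ∀ x ∈ treeOne ω, level x ≤ f → x ∈ t := by
    intro x hx hxf
    refine ⟨⟨hx, by omega⟩, ?_⟩
    rintro rfl
    simp [level] at hxf
  have hclosed : ∀ x y, (graphOn t).Adj x y → level x ≤ f → level y ≤ f := by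
    intro x y h hxf
    obtain ⟨-, hx, hy, h | h⟩ := graphOn_adj.1 h
    · by_cases hxu : x = u (level x)
      · have hlt : level x ≠ f := by
          intro hl
          rw [hl] at hxu
          rw [hxu, parent_u] at h
          exact hy.2 h.symm
        rw [hxu, parent_u] at h
        rw [← h, level_u]
        omega
      · rw [← h, level_parent hxu]
        exact hxf
    · exact (level_le_level_parent y).trans (h ▸ hxf)
  ext x
  constructor
  · rintro ⟨p⟩
    have : ∀ {x y}, (graphOn t).Walk x y → x ∈ treeOne ω ∧ level x ≤ f →
        y ∈ treeOne ω ∧ level y ≤ f := by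
      intro x y p
      induction p with
      | nil => exact id
      | cons h _ ih =>
        exact fun hx => ih ⟨((graphOn_adj.1 h).2.2.1).1.1, hclosed _ _ h hx.2⟩
    exact this p ⟨u_mem_treeOne _ _, by simp⟩
  · rintro ⟨hx, hxf⟩
    exact (reachable_u hsub (u_mem_treeOne _ 0) (by simp)).trans (reachable_u hsub hx hxf).symm

/-- After the deletion of u_{f+1}, u_0 lies in the finite tree below u_f. Since level `f` blocks by
definition, n ≤ f, and the finite result applies with K = f. -/
theorem colourTwo_eq {ω : Sample} (hω : ∀ b, FiniteHeight (attached ω b)) {n k : ℕ}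
    (hk : SecondInfiniteAt ω.2 k) (hzero : ∀ k < n, ¬ Blocks ω k) (hn : Blocks ω n) :
    colourTwo (treeTwo ω) (u 0) = finalColour ω n := by
  obtain ⟨-, f, ⟨hfk, hf⟩, huniq⟩ := id hk
  have huniq' : ∀ i < k, InfiniteAt ω.2 i → i = f := fun i hi h => huniq i ⟨hi, h⟩
  rw [colourTwo, treeTwo_eq hk, infiniteDegree_eq hfk hf huniq', component_eq hfk, if_neg]
  · refine colourIn_below hω (fun i hi h => ?_) hzero ?_
    · exact hi.ne (huniq' i (hi.trans hfk) h)
    · have hnf : n ≤ f := by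
        by_contra! h
        exact hzero f h (.inl hf)
      rcases hnf.eq_or_lt with h | h
      · exact .inl h
      · exact .inr ⟨h, hn⟩
  · simp [u]

theorem exists_secondInfiniteAt {s : ℕ → ℕ∞ × ℕ∞} (h : ∃ᶠ k in atTop, InfiniteAt s k) :
    ∃ k, SecondInfiniteAt s k := by
  classical
  rw [frequently_atTop'] at h
  obtain ⟨k0, -, hk0⟩ := h 0
  have hex : ∃ k, InfiniteAt s k := ⟨k0, hk0⟩
  obtain ⟨k1, hk1, hk1'⟩ := h (Nat.find hex)
  have hex2 : ∃ k, Nat.find hex < k ∧ InfiniteAt s k := ⟨k1, hk1, hk1'⟩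
  refine ⟨Nat.find hex2, (Nat.find_spec hex2).2, Nat.find hex,
    ⟨(Nat.find_spec hex2).1, Nat.find_spec hex⟩, ?_⟩
  rintro i ⟨hi, hi'⟩
  have h1 := Nat.find_min' hex hi'
  have h2 := Nat.find_min hex2 hi
  simp only [not_and] at h2
  by_contra hne
  exact h2 (lt_of_le_of_ne h1 (Ne.symm hne)) hi'

/-! ### Rearranging infinite products of probability spaces -/

section Product

open Measure

theorem measurePreserving_infinitePi_option {α X : Type*} [MeasurableSpace X]
    (μ : Option α → Measure X) [∀ i, IsProbabilityMeasure (μ i)] :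
    MeasurePreserving (fun (ω : Option α → X) => (ω none, fun a => ω (some a)))
      (infinitePi μ) ((μ none).prod (infinitePi fun a => μ (some a))) := by
  classical
  have hg : Measurable (fun (p : X × (α → X)) (o : Option α) => o.elim p.1 p.2) := by
    refine measurable_pi_iff.2 fun o => ?_
    cases o with
    | none => exact measurable_fst
    | some a => exact (measurable_pi_apply a).comp measurable_snd
  have hmap : ((μ none).prod (infinitePi fun a => μ (some a))).map
      (fun (p : X × (α → X)) (o : Option α) => o.elim p.1 p.2) = infinitePi μ := by
    refine eq_infinitePi μ fun s t ht => ?_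
    rw [map_apply hg (.pi s.countable_toSet fun i _ => ht i)]
    have hpre : (fun (p : X × (α → X)) (o : Option α) => o.elim p.1 p.2) ⁻¹' (Set.pi s t) =
        (if none ∈ s then t none else univ) ×ˢ
          Set.pi (Finset.eraseNone s : Finset α) (fun a => t (some a)) := by
      ext p
      simp only [Set.mem_preimage, Set.mem_pi, Set.mem_prod, Finset.mem_coe, Option.forall,
        Option.elim, Finset.mem_eraseNone]
      refine and_congr_left fun _ => ?_
      split_ifs with h <;> simp [h]
    rw [hpre, prod_prod, infinitePi_pi _ (fun i _ => ht _)]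
    by_cases h : none ∈ s
    · obtain ⟨s', rfl⟩ : ∃ s' : Finset α, s = Finset.insertNone s' :=
        ⟨Finset.eraseNone s, by simp [h]⟩
      simp [Finset.prod_insertNone]
    · obtain ⟨s', rfl⟩ : ∃ s' : Finset α, s = s'.map Function.Embedding.some :=
        ⟨Finset.eraseNone s, by simp [Finset.erase_eq_of_notMem h]⟩
      simp
  refine ⟨by fun_prop, ?_⟩
  rw [← hmap, map_map (by fun_prop) hg]
  exact map_id

theorem measurePreserving_infinitePi_option_prod {α β X : Type*} [MeasurableSpace X]
    (μ : Measure X) [IsProbabilityMeasure μ] :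
    MeasurePreserving (fun (ω : Option (α × β) → X) => (ω none, fun a b => ω (some (a, b))))
      (infinitePi fun _ => μ)
      (μ.prod (infinitePi fun _ : α => infinitePi fun _ : β => μ)) := by
  have h1 := measurePreserving_infinitePi_option (fun _ : Option (α × β) => μ)
  have h2 : MeasurePreserving (MeasurableEquiv.curry α β X) (infinitePi fun _ : α × β => μ)
      (infinitePi fun _ : α => infinitePi fun _ : β => μ) :=
    ⟨by fun_prop, infinitePi_map_curry (fun _ _ => μ)⟩
  exact ((MeasurePreserving.id μ).prod h2).comp h1

/-- It suffices to test boxes. For fixed second coordinates the section of a box has measure ∏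
μ(section at y_i); these factors are independent functions of y, so the integral factorises. -/
theorem measurePreserving_zip {ι X Y : Type*} [MeasurableSpace X] [MeasurableSpace Y]
    (μ : Measure X) (ν : Measure Y) [IsProbabilityMeasure μ] [IsProbabilityMeasure ν] :
    MeasurePreserving (fun (p : (ι → X) × (ι → Y)) i => (p.1 i, p.2 i))
      ((infinitePi fun _ : ι => μ).prod (infinitePi fun _ : ι => ν))
      (infinitePi fun _ : ι => μ.prod ν) := by
  have hm : Measurable (fun (p : (ι → X) × (ι → Y)) i => (p.1 i, p.2 i)) := by fun_prop
  refine ⟨hm, eq_infinitePi _ fun s t ht => ?_⟩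
  have hbox : MeasurableSet (Set.pi (s : Set ι) t) := .pi s.countable_toSet fun i _ => ht i
  rw [map_apply hm hbox, prod_apply_symm (hm hbox)]
  have hsec : ∀ y : ι → Y, (infinitePi fun _ : ι => μ) ((fun x => (x, y)) ⁻¹'
      ((fun (p : (ι → X) × (ι → Y)) i => (p.1 i, p.2 i)) ⁻¹' (Set.pi s t))) =
      ∏ i ∈ s, μ ((fun x => (x, y i)) ⁻¹' t i) := by
    intro y
    rw [← infinitePi_pi (fun _ : ι => μ)]
    · rfl
    · exact fun i _ => measurable_prodMk_right (ht i)
  simp_rw [hsec]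
  have hmeas : ∀ i, Measurable fun y => μ ((fun x => (x, y)) ⁻¹' t i) :=
    fun i => measurable_measure_prodMk_right (ht i)
  have hind := ProbabilityTheory.iIndepFun_infinitePi (P := fun _ : ι => ν)
    (X := fun i y => μ ((fun x => (x, y)) ⁻¹' t i)) hmeas
  refine (ProbabilityTheory.lintegral_prod_eq_prod_lintegral_of_indepFun s
    (fun i (y : ι → Y) => μ ((fun x => (x, y i)) ⁻¹' t i)) hind
    (fun i => (hmeas i).comp (measurable_pi_apply i))).trans ?_
  refine Finset.prod_congr rfl fun i _ => ?_
  rw [prod_apply_symm (ht i), ← (measurePreserving_eval_infinitePi (fun _ : ι => ν) i).lintegral_comp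
    (hmeas i)]

/-- Events of positive probability occur infinitely often in a sequence of independent trials. -/
theorem ae_frequently_infinitePi {X : Type*} [MeasurableSpace X] (μ : Measure X)
    [IsProbabilityMeasure μ] {A : Set X} (hA : MeasurableSet A) (h : μ A ≠ 0) :
    ∀ᵐ z ∂(infinitePi fun _ : ℕ => μ), ∃ᶠ k in atTop, z k ∈ A := by
  simp only [frequently_atTop]
  rw [ae_all_iff]
  intro N
  have hlt : μ Aᶜ < 1 := by
    rw [prob_compl_eq_one_sub hA]
    exact ENNReal.sub_lt_self ENNReal.one_ne_top one_ne_zero h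
  -- No success from time `N` on implies `n` failures in a row, for every `n`; the probability of
  -- these tends to 0.
  refine nonpos_iff_eq_zero.1 (ge_of_tendsto' (ENNReal.tendsto_pow_atTop_nhds_zero_of_lt_one hlt)
    fun n => ?_)
  have hbox := infinitePi_pi (fun _ : ℕ => μ) (s := Finset.Ico N (N + n)) (t := fun _ => Aᶜ)
    (fun _ _ => hA.compl)
  simp only [Finset.prod_const, Nat.card_Ico, Nat.add_sub_cancel_left] at hbox
  rw [← hbox]
  refine measure_mono fun z hz => ?_
  simp only [Set.mem_compl_iff, Set.mem_ofPred_eq, not_exists, not_and] at hz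
  exact fun i hi => hz i (Finset.mem_Ico.1 hi).1

end Product

open Measure

/-! ### The laws of the random trees -/

/-- The law of the numbers of children in a Bienaymé-Galton-Watson tree. -/
noncomputable def treeLaw (π : PMF ℕ) : Measure (List ℕ → ℕ) :=
  infinitePi fun _ => π.toMeasure

instance (π : PMF ℕ) : IsProbabilityMeasure (treeLaw π) := by
  unfold treeLaw; infer_instance

/-- The law of the trees attached to the siblings of a spine vertex, and of the numbers of the
siblings. -/
noncomputable def sideLaw (π : PMF ℕ) (σ : PMF (ℕ∞ × ℕ∞)) :
    Measure ((Bool × ℕ → List ℕ → ℕ) × (ℕ∞ × ℕ∞)) :=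
  (infinitePi fun _ => treeLaw π).prod σ.toMeasure

instance (π : PMF ℕ) (σ : PMF (ℕ∞ × ℕ∞)) : IsProbabilityMeasure (sideLaw π σ) := by
  unfold sideLaw; infer_instance

/-- The branching property: a word is empty or starts with the index of a child, and so the number
of children of the root and their subtrees are independent. -/
theorem measurePreserving_sub (π : PMF ℕ) :
    MeasurePreserving (fun ξ : List ℕ → ℕ => (ξ [], fun i => sub ξ i)) (treeLaw π)
      (π.toMeasure.prod (infinitePi fun _ : ℕ => treeLaw π)) := by
  have hinj : Function.Injective
      (fun o : Option (ℕ × List ℕ) => o.elim [] fun p => p.1 :: p.2) := by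
    rintro (_ | ⟨i, l⟩) (_ | ⟨j, l'⟩) h <;> simp_all
  have h1 : MeasurePreserving (fun (ξ : List ℕ → ℕ) (o : Option (ℕ × List ℕ)) =>
      ξ (o.elim [] fun p => p.1 :: p.2)) (treeLaw π) (infinitePi fun _ => π.toMeasure) :=
    ⟨by fun_prop, map_infinitePi_infinitePi_of_inj (P := fun _ : List ℕ => π.toMeasure) hinj⟩
  exact (measurePreserving_infinitePi_option_prod (α := ℕ) (β := List ℕ) π.toMeasure).comp h1

/-- The tree attached to `u_0`, and for each `k` the trees attached to the siblings of `u_k`, with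
the numbers of these siblings. -/
def decompose (ω : Sample) :
    (List ℕ → ℕ) × (ℕ → (Bool × ℕ → List ℕ → ℕ) × (ℕ∞ × ℕ∞)) :=
  (attached ω none, fun k => (fun p => attached ω (some (k, p)), ω.2 k))

/-- This is the source of all independence along the spine: the tree at u_0 is independent of the
sides of u_1, u_2, …, which are independent and identically distributed. -/
theorem measurePreserving_decompose (π : PMF ℕ) (σ : PMF (ℕ∞ × ℕ∞)) :
    MeasurePreserving decompose
      ((infinitePi (fun _ : Base × List ℕ => π.toMeasure)).prod
        (infinitePi (fun _ : ℕ => σ.toMeasure)))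
      ((treeLaw π).prod (infinitePi fun _ : ℕ => sideLaw π σ)) := by
  have h1 : MeasurePreserving (MeasurableEquiv.curry Base (List ℕ) ℕ)
      (infinitePi fun _ : Base × List ℕ => π.toMeasure) (infinitePi fun _ : Base => treeLaw π) :=
    ⟨by fun_prop, infinitePi_map_curry (fun _ _ => π.toMeasure)⟩
  have h2 := (measurePreserving_infinitePi_option_prod (α := ℕ) (β := Bool × ℕ)
    (treeLaw π)).comp h1
  have h3 := h2.prod (MeasurePreserving.id (infinitePi fun _ : ℕ => σ.toMeasure))
  have h4 := (measurePreserving_prodAssoc _ _ _).comp h3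
  exact ((MeasurePreserving.id (treeLaw π)).prod
    (measurePreserving_zip (ι := ℕ) (infinitePi fun _ : Bool × ℕ => treeLaw π) σ.toMeasure)).comp h4

/-! ### Probabilities of events in the random trees -/

theorem measurable_sub (i : ℕ) : Measurable fun ξ : List ℕ → ℕ => sub ξ i :=
  measurable_pi_iff.2 fun l => measurable_pi_apply (i :: l)

theorem measurableSet_forall_lt {C : ℕ → Set (List ℕ → ℕ)} (hC : ∀ i, MeasurableSet (C i)) :
    MeasurableSet {ξ : List ℕ → ℕ | ∀ i < ξ [], ξ ∈ C i} := by
  have : {ξ : List ℕ → ℕ | ∀ i < ξ [], ξ ∈ C i} = ⋂ i, ({ξ | i < ξ []}ᶜ ∪ C i) := by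
    ext ξ
    simp [imp_iff_not_or]
  rw [this]
  exact .iInter fun i =>
    ((measurableSet_lt measurable_const (measurable_pi_apply [])).compl).union (hC i)

theorem measurableSet_heightLT (n : ℕ) : MeasurableSet {ξ | HeightLT n ξ} := by
  induction n with
  | zero => exact .empty
  | succ n ih => exact measurableSet_forall_lt fun i => measurable_sub i ih

theorem measurableSet_redUpTo (n : ℕ) : MeasurableSet {ξ | RedUpTo n ξ} := by
  induction n with
  | zero => exact .empty
  | succ n ih => exact measurableSet_forall_lt fun i => (measurable_sub i ih).compl

theorem measurableSet_finiteHeight : MeasurableSet {ξ | FiniteHeight ξ} := by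
  have : {ξ | FiniteHeight ξ} = ⋃ n, {ξ | HeightLT n ξ} := by ext; simp [FiniteHeight]
  rw [this]
  exact .iUnion measurableSet_heightLT

theorem measurableSet_rootRed : MeasurableSet {ξ | RootRed ξ} := by
  have : {ξ | RootRed ξ} = ⋃ n, ({ξ | HeightLT n ξ} ∩ {ξ | RedUpTo n ξ}) := by ext; simp [RootRed]
  rw [this]
  exact .iUnion fun n => (measurableSet_heightLT n).inter (measurableSet_redUpTo n)

theorem lintegral_pmf {α : Type*} [MeasurableSpace α] [MeasurableSingletonClass α] [Countable α]
    (p : PMF α) (f : α → ℝ≥0∞) : ∫⁻ a, f a ∂p.toMeasure = ∑' a, p a * f a := by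
  rw [lintegral_countable']
  refine tsum_congr fun a => ?_
  rw [p.toMeasure_apply_singleton _ (measurableSet_singleton a), mul_comm]

theorem measurableSet_children {E : ℕ → Set (ℕ → List ℕ → ℕ)} (hE : ∀ k, MeasurableSet (E k)) :
    MeasurableSet {p : ℕ × (ℕ → List ℕ → ℕ) | p.2 ∈ E p.1} := by
  have : {p : ℕ × (ℕ → List ℕ → ℕ) | p.2 ∈ E p.1} = ⋃ k, {k} ×ˢ E k := by
    ext ⟨k, y⟩
    simp
  rw [this]
  exact .iUnion fun k => (measurableSet_singleton k).prod (hE k)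

/-- Conditioning on the number of children of the root. -/
theorem treeLaw_children (π : PMF ℕ) {E : ℕ → Set (ℕ → List ℕ → ℕ)}
    (hE : ∀ k, MeasurableSet (E k)) :
    treeLaw π {ξ | (fun i => sub ξ i) ∈ E (ξ [])} =
      ∑' k, π k * (infinitePi fun _ : ℕ => treeLaw π) (E k) := by
  have hm := measurableSet_children hE
  have h := (measurePreserving_sub π).measure_preimage hm.nullMeasurableSet
  refine h.trans ?_
  rw [prod_apply hm, lintegral_pmf]
  rfl

theorem infinitePi_forall_lt {X : Type*} [MeasurableSpace X] (μ : Measure X)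
    [IsProbabilityMeasure μ] {A : Set X} (hA : MeasurableSet A) (k : ℕ) :
    (infinitePi fun _ : ℕ => μ) {y | ∀ i < k, y i ∈ A} = μ A ^ k := by
  have h := infinitePi_pi (fun _ : ℕ => μ) (s := Finset.range k) (t := fun _ => A)
    (fun _ _ => hA)
  simp only [Finset.prod_const, Finset.card_range] at h
  rw [← h]
  congr 1
  ext y
  simp

theorem measurableSet_forall_lt_seq {X : Type*} [MeasurableSpace X] {A : Set X}
    (hA : MeasurableSet A) (k : ℕ) : MeasurableSet {y : ℕ → X | ∀ i < k, y i ∈ A} := by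
  have : {y : ℕ → X | ∀ i < k, y i ∈ A} = ⋂ i ∈ Finset.range k, (fun y => y i) ⁻¹' A := by
    ext; simp
  rw [this]
  exact Finset.measurableSet_biInter _ fun i _ => measurable_pi_apply i hA

open Classical in
-- Disjoint union over the position `j` of the only success among `k` trials.
theorem infinitePi_card_filter_eq_one {X : Type*} [MeasurableSpace X] (μ : Measure X)
    [IsProbabilityMeasure μ] {A : Set X} (hA : MeasurableSet A) (k : ℕ) :
    MeasurableSet {y : ℕ → X | ((Finset.range k).filter (fun i => y i ∈ A)).card = 1} ∧
    (infinitePi fun _ : ℕ => μ) {y | ((Finset.range k).filter (fun i => y i ∈ A)).card = 1} =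
      k * (μ A * (1 - μ A) ^ (k - 1)) := by
  have hset : {y : ℕ → X | ((Finset.range k).filter (fun i => y i ∈ A)).card = 1} =
      ⋃ j ∈ Finset.range k, Set.pi (Finset.range k) (fun i => if i = j then A else Aᶜ) := by
    ext y
    simp only [Set.mem_ofPred_eq, Finset.card_eq_one, Set.mem_iUnion, Set.mem_pi, Finset.mem_coe,
      Finset.mem_range, exists_prop]
    refine exists_congr fun j => ?_
    constructor
    · intro h
      have hj : j ∈ (Finset.range k).filter (fun i => y i ∈ A) := by simp [h]
      refine ⟨(Finset.mem_range.1 (Finset.mem_filter.1 hj).1), fun i hi => ?_⟩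
      split_ifs with hij
      · exact hij ▸ (Finset.mem_filter.1 hj).2
      · intro hyi
        have : i ∈ (Finset.range k).filter (fun i => y i ∈ A) := by simp [hi, hyi]
        rw [h, Finset.mem_singleton] at this
        exact hij this
    · rintro ⟨hj, h⟩
      ext i
      simp only [Finset.mem_filter, Finset.mem_range, Finset.mem_singleton]
      constructor
      · rintro ⟨hi, hyi⟩
        by_contra hij
        have := h i hi
        rw [if_neg hij] at this
        exact this hyi
      · rintro rfl
        have := h i hj
        rw [if_pos rfl] at this
        exact ⟨hj, this⟩
  have hbox : ∀ i j : ℕ, MeasurableSet (if i = j then A else Aᶜ) := by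
    intro i j
    split_ifs
    exacts [hA, hA.compl]
  have hpi : ∀ j, MeasurableSet (Set.pi (Finset.range k : Set ℕ) (fun i => if i = j then A else Aᶜ)) :=
    fun j => .pi (Finset.countable_toSet _) fun i _ => hbox i j
  rw [hset]
  refine ⟨Finset.measurableSet_biUnion _ fun j _ => hpi j, ?_⟩
  rw [measure_biUnion_finset]
  · have hval : ∀ j ∈ Finset.range k, (infinitePi fun _ : ℕ => μ)
        (Set.pi (Finset.range k : Set ℕ) (fun i => if i = j then A else Aᶜ)) =
        μ A * (1 - μ A) ^ (k - 1) := by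
      intro j hj
      rw [infinitePi_pi _ (fun i _ => hbox i j), ← Finset.mul_prod_erase _ _ hj, if_pos rfl]
      congr 1
      rw [Finset.prod_congr rfl (g := fun _ => 1 - μ A)]
      · rw [Finset.prod_const, Finset.card_erase_of_mem hj, Finset.card_range]
      · intro i hi
        rw [if_neg (Finset.ne_of_mem_erase hi), prob_compl_eq_one_sub hA]
    rw [Finset.sum_congr rfl hval, Finset.sum_const, Finset.card_range, nsmul_eq_mul]
  · intro j hj j' hj' hne
    rw [Function.onFun, Set.disjoint_left]
    intro y hy hy'
    have h1 := hy j hj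
    have h2 := hy' j hj
    simp only [if_pos, hne, if_false] at h1 h2
    exact h2 h1
  · exact fun j _ => hpi j

theorem treeLaw_finiteHeight (π : PMF ℕ) :
    treeLaw π {ξ | FiniteHeight ξ} = ∑' k, π k * treeLaw π {ξ | FiniteHeight ξ} ^ k := by
  have h := treeLaw_children π (E := fun k => {y | ∀ i < k, y i ∈ {ξ | FiniteHeight ξ}})
    (fun k => measurableSet_forall_lt_seq measurableSet_finiteHeight k)
  simp_rw [infinitePi_forall_lt _ measurableSet_finiteHeight] at h
  rw [← h]
  congr 1
  ext ξ
  exact finiteHeight_iff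

theorem treeLaw_redCount_eq_zero (π : PMF ℕ) :
    treeLaw π {ξ | redCount ξ = 0} = ∑' k, π k * (1 - treeLaw π {ξ | RootRed ξ}) ^ k := by
  classical
  have h := treeLaw_children π (E := fun k => {y | ∀ i < k, y i ∈ {ξ | RootRed ξ}ᶜ})
    (fun k => measurableSet_forall_lt_seq measurableSet_rootRed.compl k)
  simp_rw [infinitePi_forall_lt _ measurableSet_rootRed.compl,
    prob_compl_eq_one_sub measurableSet_rootRed] at h
  rw [← h]
  congr 1
  ext ξ
  simp [redCount, Finset.filter_eq_empty_iff]

theorem treeLaw_redCount_eq_one (π : PMF ℕ) :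
    treeLaw π {ξ | redCount ξ = 1} = ∑' k : ℕ, π k * (k * (treeLaw π {ξ | RootRed ξ} *
      (1 - treeLaw π {ξ | RootRed ξ}) ^ (k - 1))) := by
  classical
  have key := fun k => infinitePi_card_filter_eq_one (treeLaw π) measurableSet_rootRed k
  have h := treeLaw_children π (fun k => (key k).1)
  simp_rw [fun k => (key k).2] at h
  rw [← h]
  simp only [redCount, Set.mem_ofPred_eq]

theorem measurableSet_redCount_eq (n : ℕ) : MeasurableSet {ξ | redCount ξ = n} := by
  classical
  have hcard : ∀ k, Measurable fun y : ℕ → List ℕ → ℕ =>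
      ((Finset.range k).filter (fun i => RootRed (y i))).card := by
    intro k
    simp only [Finset.card_filter]
    exact Finset.measurable_sum _ fun i _ => Measurable.ite
      (measurable_pi_apply (X := fun _ : ℕ => List ℕ → ℕ) i measurableSet_rootRed)
      measurable_const measurable_const
  -- The law is irrelevant here; only the measurability of the decomposition at the root is used.
  exact (measurePreserving_sub (PMF.pure 0)).measurable (measurableSet_children
    (E := fun k => {y | ((Finset.range k).filter (fun i => RootRed (y i))).card = n})
    fun k => hcard k (measurableSet_singleton n))

/-! ### The siblings of a spine vertex -/

theorem ENat.tsum_eq_top_add (f : ℕ∞ → ℝ≥0∞) : ∑' N, f N = f ⊤ + ∑' n : ℕ, f n := by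
  classical
  rw [ENNReal.tsum_eq_add_tsum_ite ⊤]
  congr 1
  rw [← Function.Injective.tsum_eq (g := fun n : ℕ => (n : ℕ∞)) Nat.cast_injective]
  · simp
  · intro N hN
    simp only [Function.mem_support, ne_eq, ite_eq_left_iff, not_forall] at hN
    obtain ⟨n, rfl⟩ := ENat.ne_top_iff_exists.1 hN.1
    exact ⟨n, rfl⟩

theorem PMF.tsum_bind_mul {α β : Type*} (p : PMF α) (f : α → PMF β) (g : β → ℝ≥0∞) :
    ∑' b, p.bind f b * g b = ∑' a, p a * ∑' b, f a b * g b := by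
  simp_rw [PMF.bind_apply, ← ENNReal.tsum_mul_right, ← ENNReal.tsum_mul_left]
  rw [ENNReal.tsum_comm]
  simp_rw [mul_assoc]

theorem PMF.tsum_pure_mul {α : Type*} (a : α) (g : α → ℝ≥0∞) :
    ∑' b, PMF.pure a b * g b = g a := by
  rw [tsum_eq_single a]
  · simp
  · intro b hb
    simp [PMF.pure_apply_of_ne _ _ hb]

/-- A function of the numbers of siblings whose value depends only on their sum. -/
noncomputable def powSiblings (x : ℝ≥0∞) (y : ℕ∞ × ℕ∞) : ℝ≥0∞ :=
  if y.1 + y.2 = ⊤ then 0 else x ^ (y.1 + y.2).toNat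

/-- Whichever of the n + 1 children is chosen, it has `n` siblings. -/
theorem tsum_positionLaw_mul (n : ℕ) (x : ℝ≥0∞) :
    ∑' y, positionLaw (n + 1) y * powSiblings x y = x ^ n := by
  -- The uniform law on `Fin (n + 1)` is carried to ℕ before the pair is formed, so the law unfolds
  -- into two binds.
  have hlaw : positionLaw (n + 1) = ((PMF.uniformOfFintype (Fin (n + 1))).bind
      fun j => PMF.pure (j : ℕ)).bind
        (fun j => PMF.pure ((j : ℕ∞), ((n - j : ℕ) : ℕ∞))) := rfl
  rw [hlaw, PMF.tsum_bind_mul]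
  simp only [PMF.tsum_pure_mul]
  rw [PMF.tsum_bind_mul]
  simp only [PMF.tsum_pure_mul]
  have : ∀ j : Fin (n + 1), powSiblings x (((j : ℕ) : ℕ∞), ((n - (j : ℕ) : ℕ) : ℕ∞)) = x ^ n := by
    intro j
    have hj : (j : ℕ) + (n - j) = n := by omega
    have h : (((j : ℕ) : ℕ∞) + ((n - (j : ℕ) : ℕ) : ℕ∞)) = (n : ℕ∞) := by
      rw [← Nat.cast_add, hj]
    simp only [powSiblings, h, ENat.natCast_ne_top, if_false, ENat.toNat_natCast]
  simp_rw [this]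
  rw [ENNReal.tsum_mul_right, PMF.tsum_coe, one_mul]

/-- The value ∞ contributes nothing by the definition of `powSiblings`, and 0 has no mass; n + 1
children leave `n` siblings, which shifts the exponent as in a derivative. -/
theorem tsum_siblingLaw_mul (w : ℕ → ℝ≥0) (τ : ℝ≥0∞) (h0 : sizeBiasedLaw w τ 0 = 0) (x : ℝ≥0∞) :
    ∑' y, siblingLaw w τ y * powSiblings x y =
      ∑' n : ℕ, sizeBiasedLaw w τ ((n + 1 : ℕ) : ℕ∞) * x ^ n := by
  rw [siblingLaw, PMF.tsum_bind_mul, ENat.tsum_eq_top_add]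
  have htop : ∑' b, (PMF.pure ((⊤ : ℕ∞), (⊤ : ℕ∞))) b * powSiblings x b = 0 := by
    rw [PMF.tsum_pure_mul]
    simp [powSiblings]
  rw [if_pos rfl, htop, mul_zero, zero_add, tsum_eq_zero_add' ENNReal.summable]
  simp only [Nat.cast_zero, h0, zero_mul, zero_add, ENat.natCast_ne_top, if_false, ENat.toNat_natCast,
    tsum_positionLaw_mul]

/-- Whether there is a sibling at the given place. -/
def Present (y : ℕ∞ × ℕ∞) (p : Bool × ℕ) : Prop := (p.2 : ℕ∞) < if p.1 then y.2 else y.1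

theorem basePresent_iff {s : ℕ → ℕ∞ × ℕ∞} {k : ℕ} {p : Bool × ℕ} :
    BasePresent s (some (k, p)) ↔ Present (s k) p := by
  rcases p with ⟨_ | _, i⟩ <;> rfl

theorem exists_finset_present {y : ℕ∞ × ℕ∞} (h : y.1 + y.2 ≠ ⊤) :
    ∃ F : Finset (Bool × ℕ), (∀ p, p ∈ F ↔ Present y p) ∧ F.card = (y.1 + y.2).toNat := by
  classical
  obtain ⟨y1, y2⟩ := y
  simp only [ne_eq, ENat.add_eq_top, not_or] at h
  obtain ⟨l, rfl⟩ := ENat.ne_top_iff_exists.1 h.1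
  obtain ⟨r, rfl⟩ := ENat.ne_top_iff_exists.1 h.2
  refine ⟨({false} ×ˢ Finset.range l) ∪ ({true} ×ˢ Finset.range r), ?_, ?_⟩
  · rintro ⟨_ | _, i⟩ <;> simp [Present]
  · rw [Finset.card_union_of_disjoint]
    · rw [← Nat.cast_add, ENat.toNat_natCast]
      simp
    · rw [Finset.disjoint_left]
      rintro ⟨_ | _, i⟩ <;> simp

/-- There are finitely many siblings, and none of them is red. -/
def openSides : Set ((Bool × ℕ → List ℕ → ℕ) × (ℕ∞ × ℕ∞)) :=
  {c | c.2.1 + c.2.2 ≠ ⊤ ∧ ∀ p, Present c.2 p → c.1 p ∈ {ξ | RootRed ξ}ᶜ}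

theorem not_blocks_iff {ω : Sample} {k : ℕ} : ¬ Blocks ω k ↔ (decompose ω).2 k ∈ openSides := by
  simp only [Blocks, not_or, Set.not_nonempty_iff_eq_empty, Set.eq_empty_iff_forall_notMem,
    redSides, basePresent_iff, openSides, decompose, InfiniteAt, Set.mem_ofPred_eq, not_and,
    Set.mem_compl_iff, ne_eq]

theorem measurableSet_openSides : MeasurableSet openSides := by
  have : openSides = (Prod.snd ⁻¹' {y : ℕ∞ × ℕ∞ | y.1 + y.2 ≠ ⊤}) ∩
      ⋂ p, ((Prod.snd ⁻¹' {y | Present y p})ᶜ ∪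
        (fun c : (Bool × ℕ → List ℕ → ℕ) × (ℕ∞ × ℕ∞) => c.1 p) ⁻¹' {ξ | RootRed ξ}ᶜ) := by
    ext c
    simp [openSides, imp_iff_not_or]
  rw [this]
  refine (measurable_snd .of_discrete).inter (.iInter fun p => ?_)
  exact (measurable_snd .of_discrete).compl.union
    (((measurable_pi_apply p).comp measurable_fst) measurableSet_rootRed.compl)

/-- Given finitely many siblings, none is red with the corresponding power of the probability of a
root that is not red; given infinitely many, the event fails by definition. -/
theorem sideLaw_openSides (π : PMF ℕ) (σ : PMF (ℕ∞ × ℕ∞)) :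
    sideLaw π σ openSides = ∑' y, σ y * powSiblings (1 - treeLaw π {ξ | RootRed ξ}) y := by
  rw [sideLaw, prod_apply_symm measurableSet_openSides, lintegral_pmf]
  refine tsum_congr fun y => ?_
  congr 1
  by_cases h : y.1 + y.2 = ⊤
  · have : (fun x => (x, y)) ⁻¹' openSides = ∅ := by
      ext x
      simp [openSides, h, -ENat.add_eq_top]
    rw [this, measure_empty, powSiblings, if_pos h]
  · obtain ⟨F, hF, hcard⟩ := exists_finset_present h
    have : (fun x => (x, y)) ⁻¹' openSides =
        Set.pi (F : Set (Bool × ℕ)) fun _ => {ξ | RootRed ξ}ᶜ := by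
      ext x
      simp [openSides, h, Set.mem_pi, hF, -ENat.add_eq_top]
    rw [this, infinitePi_pi _ (fun _ _ => measurableSet_rootRed.compl), Finset.prod_const, hcard,
      prob_compl_eq_one_sub measurableSet_rootRed, powSiblings, if_neg h]

/-- There are two red siblings. -/
theorem sideLaw_twoRed_ne_zero (π : PMF ℕ) (σ : PMF (ℕ∞ × ℕ∞)) {y : ℕ∞ × ℕ∞} (hy : σ y ≠ 0)
    (p p' : Bool × ℕ) (hred : treeLaw π {ξ | RootRed ξ} ≠ 0) :
    sideLaw π σ {c | c.2 = y ∧ RootRed (c.1 p) ∧ RootRed (c.1 p')} ≠ 0 := by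
  classical
  have hset : {c : (Bool × ℕ → List ℕ → ℕ) × (ℕ∞ × ℕ∞) |
      c.2 = y ∧ RootRed (c.1 p) ∧ RootRed (c.1 p')} =
      (Set.pi (({p, p'} : Finset (Bool × ℕ)) : Set (Bool × ℕ)) fun _ => {ξ | RootRed ξ}) ×ˢ {y} := by
    ext c
    simp [and_comm]
  rw [hset, sideLaw, prod_prod, infinitePi_pi _ (fun _ _ => measurableSet_rootRed),
    σ.toMeasure_apply_singleton _ (measurableSet_singleton y), Finset.prod_const]
  exact mul_ne_zero (pow_ne_zero _ hred) hy

theorem measurableSet_twoRed (y : ℕ∞ × ℕ∞) (p p' : Bool × ℕ) :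
    MeasurableSet {c : (Bool × ℕ → List ℕ → ℕ) × (ℕ∞ × ℕ∞) |
      c.2 = y ∧ RootRed (c.1 p) ∧ RootRed (c.1 p')} :=
  (measurable_snd (measurableSet_singleton y)).inter
    ((((measurable_pi_apply (X := fun _ => List ℕ → ℕ) p).comp measurable_fst)
      measurableSet_rootRed).inter
      (((measurable_pi_apply (X := fun _ => List ℕ → ℕ) p').comp measurable_fst)
        measurableSet_rootRed))

/-! ### The first success in a sequence of independent trials -/

section FirstSuccess

variable {X : Type*}

/-- The first failure has an odd index. -/
def oddFirst (S : Set X) : Set (ℕ → X) := {z | ∃ n, Odd n ∧ (∀ k < n, z k ∈ S) ∧ z n ∉ S}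

theorem oddFirst_eq (S : Set X) :
    oddFirst S = ⋃ m : ℕ, {z | (∀ k < 2 * m + 1, z k ∈ S) ∧ z (2 * m + 1) ∉ S} := by
  ext z
  simp only [oddFirst, Odd, Set.mem_iUnion, Set.mem_ofPred_eq]
  constructor
  · rintro ⟨n, ⟨m, rfl⟩, h⟩
    exact ⟨m, h⟩
  · rintro ⟨m, h⟩
    exact ⟨_, ⟨m, rfl⟩, h⟩

variable [MeasurableSpace X]

theorem measurableSet_firstFailure {S : Set X} (hS : MeasurableSet S) (n : ℕ) :
    MeasurableSet {z : ℕ → X | (∀ k < n, z k ∈ S) ∧ z n ∉ S} :=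
  (measurableSet_forall_lt_seq hS n).inter (measurable_pi_apply n hS).compl

theorem measurableSet_oddFirst {S : Set X} (hS : MeasurableSet S) : MeasurableSet (oddFirst S) := by
  rw [oddFirst_eq]
  exact .iUnion fun m => measurableSet_firstFailure hS _

theorem infinitePi_firstFailure (μ : Measure X) [IsProbabilityMeasure μ] {S : Set X}
    (hS : MeasurableSet S) (n : ℕ) :
    (infinitePi fun _ : ℕ => μ) {z | (∀ k < n, z k ∈ S) ∧ z n ∉ S} = μ S ^ n * (1 - μ S) := by
  have hmeas : ∀ i ∈ Finset.range (n + 1), MeasurableSet (if i < n then S else Sᶜ) := by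
    intro i _
    split_ifs
    exacts [hS, hS.compl]
  have h := infinitePi_pi (fun _ : ℕ => μ) (t := fun i => if i < n then S else Sᶜ) hmeas
  rw [Finset.prod_range_succ, if_neg (lt_irrefl n), prob_compl_eq_one_sub hS,
    Finset.prod_congr rfl (g := fun _ => μ S)
      (fun i hi => by rw [if_pos (Finset.mem_range.1 hi)]),
    Finset.prod_const, Finset.card_range] at h
  rw [← h]
  congr 1
  ext z
  simp only [Set.mem_pi, Finset.mem_coe, Finset.mem_range, Set.mem_ofPred_eq]
  constructor
  · rintro ⟨h1, h2⟩ i hi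
    split_ifs with hin
    · exact h1 i hin
    · obtain rfl : i = n := by omega
      exact h2
  · intro hz
    refine ⟨fun k hk => ?_, ?_⟩
    · have := hz k (by omega)
      rwa [if_pos hk] at this
    · have := hz n (by omega)
      rwa [if_neg (lt_irrefl n)] at this

/-- The geometric sum ∑ d^(2m+1) (1 - d) equals d (1 - d) / (1 - d²). -/
theorem infinitePi_oddFirst (μ : Measure X) [IsProbabilityMeasure μ] {S : Set X}
    (hS : MeasurableSet S) {d : ℝ} (hd0 : 0 ≤ d) (hd1 : d < 1) (hd : μ S = ENNReal.ofReal d) :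
    (infinitePi fun _ : ℕ => μ).real (oddFirst S) = d / (1 + d) := by
  have hdisj : Pairwise (Function.onFun Disjoint fun m : ℕ =>
      {z : ℕ → X | (∀ k < 2 * m + 1, z k ∈ S) ∧ z (2 * m + 1) ∉ S}) := by
    have : ∀ m m' : ℕ, m < m' → Disjoint
        {z : ℕ → X | (∀ k < 2 * m + 1, z k ∈ S) ∧ z (2 * m + 1) ∉ S}
        {z : ℕ → X | (∀ k < 2 * m' + 1, z k ∈ S) ∧ z (2 * m' + 1) ∉ S} := by
      intro m m' h
      rw [Set.disjoint_left]
      rintro z ⟨-, h1⟩ ⟨h2, -⟩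
      exact h1 (h2 _ (by omega))
    intro m m' hne
    rcases hne.lt_or_gt with h | h
    · exact this m m' h
    · exact (this m' m h).symm
  rw [measureReal_def, oddFirst_eq, measure_iUnion hdisj fun m => measurableSet_firstFailure hS _]
  simp_rw [infinitePi_firstFailure μ hS, hd]
  have hsq : d ^ 2 < 1 := by nlinarith
  have hterm : ∀ m : ℕ, ENNReal.ofReal d ^ (2 * m + 1) * (1 - ENNReal.ofReal d) =
      ENNReal.ofReal ((d ^ 2) ^ m * (d * (1 - d))) := by
    intro m
    rw [← ENNReal.ofReal_pow hd0, ← ENNReal.ofReal_one, ← ENNReal.ofReal_sub _ hd0,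
      ← ENNReal.ofReal_mul (by positivity)]
    congr 1
    rw [pow_succ, pow_mul]
    ring
  simp_rw [hterm]
  have hsum := (hasSum_geometric_of_lt_one (sq_nonneg d) hsq).mul_right (d * (1 - d))
  rw [← ENNReal.ofReal_tsum_of_nonneg _ hsum.summable, hsum.tsum_eq, ENNReal.toReal_ofReal]
  · have h1 : (1 : ℝ) - d ≠ 0 := by linarith
    have h2 : (1 : ℝ) + d ≠ 0 := by linarith
    have h3 : (1 : ℝ) - d ^ 2 = (1 - d) * (1 + d) := by ring
    rw [h3]
    field_simp
  · have : 0 < 1 - d ^ 2 := by linarith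
    have : 0 ≤ 1 - d := by linarith
    positivity
  · intro m
    have : 0 ≤ 1 - d := by linarith
    positivity

end FirstSuccess

/-! ### The law of the colour of `u_0` -/

/-- The law of the random input, for a general offspring law and a general law of the numbers of
siblings of the spine vertices. -/
noncomputable def inputLaw (π : PMF ℕ) (σ : PMF (ℕ∞ × ℕ∞)) : Measure Sample :=
  (infinitePi (fun _ : Base × List ℕ => π.toMeasure)).prod
    (infinitePi (fun _ : ℕ => σ.toMeasure))

instance (π : PMF ℕ) (σ : PMF (ℕ∞ × ℕ∞)) : IsProbabilityMeasure (inputLaw π σ) := by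
  unfold inputLaw; infer_instance

theorem ae_finiteHeight_attached {π : PMF ℕ} (σ : PMF (ℕ∞ × ℕ∞))
    (h : treeLaw π {ξ | FiniteHeight ξ} = 1) :
    ∀ᵐ ω ∂inputLaw π σ, ∀ b, FiniteHeight (attached ω b) := by
  rw [ae_all_iff]
  intro b
  have h1 : MeasurePreserving (MeasurableEquiv.curry Base (List ℕ) ℕ)
      (infinitePi fun _ : Base × List ℕ => π.toMeasure) (infinitePi fun _ : Base => treeLaw π) :=
    ⟨by fun_prop, infinitePi_map_curry (fun _ _ => π.toMeasure)⟩
  have h2 := ((measurePreserving_eval_infinitePi (fun _ : Base => treeLaw π) b).comp h1).comp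
    (measurePreserving_fst (ν := infinitePi (fun _ : ℕ => σ.toMeasure)))
  exact h2.quasiMeasurePreserving.ae
    ((prob_compl_eq_zero_iff measurableSet_finiteHeight).2 h)

theorem ae_frequently_decompose (π : PMF ℕ) (σ : PMF (ℕ∞ × ℕ∞))
    {A : Set ((Bool × ℕ → List ℕ → ℕ) × (ℕ∞ × ℕ∞))} (hA : MeasurableSet A)
    (h : sideLaw π σ A ≠ 0) :
    ∀ᵐ ω ∂inputLaw π σ, ∃ᶠ k in atTop, (decompose ω).2 k ∈ A :=
  (measurePreserving_snd.comp (measurePreserving_decompose π σ)).quasiMeasurePreserving.ae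
    (ae_frequently_infinitePi (sideLaw π σ) hA h)

theorem ae_not_infiniteAt (π : PMF ℕ) {σ : PMF (ℕ∞ × ℕ∞)}
    (h : ∀ y : ℕ∞ × ℕ∞, y.1 + y.2 = ⊤ → σ y = 0) :
    ∀ᵐ ω ∂inputLaw π σ, ∀ k, ¬ InfiniteAt ω.2 k := by
  rw [ae_all_iff]
  intro k
  have h0 : ∀ᵐ y ∂σ.toMeasure, ¬ y.1 + y.2 = ⊤ := by
    refine (σ.toMeasure_apply_eq_zero_iff .of_discrete).2 ?_
    rw [Set.disjoint_left]
    intro y hy hy'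
    exact hy (h y (not_not.1 hy'))
  exact ((measurePreserving_eval_infinitePi (fun _ : ℕ => σ.toMeasure) k).comp
    (measurePreserving_snd (μ := infinitePi (fun _ : Base × List ℕ => π.toMeasure)))
    ).quasiMeasurePreserving.ae h0

theorem ae_exists_first_blocks {π : PMF ℕ} {σ : PMF (ℕ∞ × ℕ∞)}
    (h : sideLaw π σ openSides < 1) :
    ∀ᵐ ω ∂inputLaw π σ, ∃ n, (∀ k < n, ¬ Blocks ω k) ∧ Blocks ω n := by
  classical
  have h' : sideLaw π σ openSidesᶜ ≠ 0 := by
    rw [prob_compl_eq_one_sub measurableSet_openSides]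
    exact (tsub_pos_of_lt h).ne'
  filter_upwards [ae_frequently_decompose π σ measurableSet_openSides.compl h'] with ω hω
  have hex : ∃ n, Blocks ω n := by
    obtain ⟨n, hn⟩ := hω.exists
    exact ⟨n, not_not.1 fun hb => hn (not_blocks_iff.1 hb)⟩
  exact ⟨Nat.find hex, fun k hk => Nat.find_min hex hk, Nat.find_spec hex⟩

theorem mem_oddFirst_decompose {ω : Sample} {n : ℕ} (hn : ∀ k < n, ¬ Blocks ω k)
    (hb : Blocks ω n) : (decompose ω).2 ∈ oddFirst openSides ↔ Odd n := by
  constructor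
  · rintro ⟨m, hm, h1, h2⟩
    have hm' : Blocks ω m := not_not.1 fun h => h2 (not_blocks_iff.1 h)
    rcases lt_trichotomy n m with h | rfl | h
    · exact absurd hb (not_blocks_iff.2 (h1 n h))
    · exact hm
    · exact absurd hm' (hn m h)
  · intro h
    exact ⟨n, h, fun k hk => not_blocks_iff.1 (hn k hk), fun h' => not_blocks_iff.2 h' hb⟩

theorem finalColour_eq_red {ω : Sample} {n : ℕ} :
    finalColour ω n = Colour.red ↔ redCount (attached ω none) = 0 ∧ ¬ Odd n := by
  unfold finalColour
  by_cases h : Odd n <;> simp [h, colourOf_eq_red]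

theorem colourOf_eq_orange {e : ℕ} : colourOf e = Colour.orange ↔ e = 1 := by
  match e with
  | 0 => simp [colourOf]
  | 1 => simp [colourOf]
  | e + 2 => simp [colourOf]

theorem finalColour_eq_orange {ω : Sample} {n : ℕ} :
    finalColour ω n = Colour.orange ↔ redCount (attached ω none) = 1 ∧ ¬ Odd n ∨
      redCount (attached ω none) = 0 ∧ Odd n := by
  unfold finalColour
  by_cases h : Odd n <;> simp [h, colourOf_eq_orange]

/-- Almost surely, red means B = 0 and n even, orange means B = 1 and n even or B = 0 and n odd, and
green is the rest. The number B of red children and the parity of n are independent. The events `E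
c` need only agree almost surely with these measurable sets. -/
theorem isColourLaw_of_ae {π : PMF ℕ} {σ : PMF (ℕ∞ × ℕ∞)} {q d : ℝ} (hq : 0 ≤ q)
    (hd0 : 0 ≤ d) (hd1 : d < 1) (hB0 : treeLaw π {ξ | redCount ξ = 0} = ENNReal.ofReal q)
    (hB1 : treeLaw π {ξ | redCount ξ = 1} = ENNReal.ofReal (q * d))
    (hS : sideLaw π σ openSides = ENNReal.ofReal d) {E : Colour → Sample → Prop}
    (hE : ∀ᵐ ω ∂inputLaw π σ, ∀ n, (∀ k < n, ¬ Blocks ω k) → Blocks ω n →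
      ∀ c, E c ω ↔ finalColour ω n = c) :
    IsColourLaw (fun c => (inputLaw π σ).real {ω | E c ω}) q d := by
  have hO := measurableSet_oddFirst measurableSet_openSides
  set A : ℕ → Set Sample := fun i => decompose ⁻¹' ({ξ | redCount ξ = i} ×ˢ oddFirst openSides)
  set A' : ℕ → Set Sample := fun i => decompose ⁻¹' ({ξ | redCount ξ = i} ×ˢ (oddFirst openSides)ᶜ)
  have hmp : MeasurePreserving decompose (inputLaw π σ)
      ((treeLaw π).prod (infinitePi fun _ : ℕ => sideLaw π σ)) := measurePreserving_decompose π σ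
  have hAm : ∀ i, MeasurableSet (A i) := fun i =>
    hmp.measurable ((measurableSet_redCount_eq i).prod hO)
  have hAm' : ∀ i, MeasurableSet (A' i) := fun i =>
    hmp.measurable ((measurableSet_redCount_eq i).prod hO.compl)
  have hodd := infinitePi_oddFirst (sideLaw π σ) measurableSet_openSides hd0 hd1 hS
  have hB0' : (treeLaw π).real {ξ | redCount ξ = 0} = q := by
    rw [measureReal_def, hB0, ENNReal.toReal_ofReal hq]
  have hB1' : (treeLaw π).real {ξ | redCount ξ = 1} = q * d := by
    rw [measureReal_def, hB1, ENNReal.toReal_ofReal (by positivity)]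
  have hA : ∀ i, (inputLaw π σ).real (A i) =
      (treeLaw π).real {ξ | redCount ξ = i} * (d / (1 + d)) := by
    intro i
    rw [hmp.measureReal_preimage ((measurableSet_redCount_eq i).prod hO).nullMeasurableSet,
      measureReal_prod_prod, hodd]
  have hA' : ∀ i, (inputLaw π σ).real (A' i) =
      (treeLaw π).real {ξ | redCount ξ = i} * (1 - d / (1 + d)) := by
    intro i
    rw [hmp.measureReal_preimage ((measurableSet_redCount_eq i).prod hO.compl).nullMeasurableSet,
      measureReal_prod_prod, probReal_compl_eq_one_sub hO, hodd]
  have hlt : sideLaw π σ openSides < 1 := by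
    rw [hS, ENNReal.ofReal_lt_one]
    exact hd1
  have key : ∀ᵐ ω ∂inputLaw π σ, (E Colour.red ω ↔ ω ∈ A' 0) ∧
      (E Colour.orange ω ↔ ω ∈ A' 1 ∪ A 0) ∧
      (E Colour.green ω ↔ ω ∈ (A' 0 ∪ (A' 1 ∪ A 0))ᶜ) := by
    filter_upwards [hE, ae_exists_first_blocks hlt] with ω h1 ⟨n, hn, hb⟩
    have h2 := h1 n hn hb
    have hA : ∀ i, ω ∈ A i ↔ redCount (attached ω none) = i ∧ Odd n :=
      fun i => and_congr_right fun _ => mem_oddFirst_decompose hn hb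
    have hA' : ∀ i, ω ∈ A' i ↔ redCount (attached ω none) = i ∧ ¬ Odd n :=
      fun i => and_congr_right fun _ => not_congr (mem_oddFirst_decompose hn hb)
    have hred : finalColour ω n = Colour.red ↔ ω ∈ A' 0 := by rw [finalColour_eq_red, hA']
    have hor : finalColour ω n = Colour.orange ↔ ω ∈ A' 1 ∪ A 0 := by
      rw [finalColour_eq_orange, Set.mem_union, hA, hA']
    refine ⟨(h2 _).trans hred, (h2 _).trans hor, (h2 _).trans ?_⟩
    rw [Set.mem_compl_iff, Set.mem_union, ← hred, ← hor]
    cases finalColour ω n <;> simp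
  have hr : (inputLaw π σ).real {ω | E Colour.red ω} = (inputLaw π σ).real (A' 0) :=
    measureReal_congr (by filter_upwards [key] with ω h using propext h.1)
  have ho : (inputLaw π σ).real {ω | E Colour.orange ω} = (inputLaw π σ).real (A' 1 ∪ A 0) :=
    measureReal_congr (by filter_upwards [key] with ω h using propext h.2.1)
  have hg : (inputLaw π σ).real {ω | E Colour.green ω} =
      (inputLaw π σ).real (A' 0 ∪ (A' 1 ∪ A 0))ᶜ :=
    measureReal_congr (by filter_upwards [key] with ω h using propext h.2.2)
  have hdisj : Disjoint (A' 1) (A 0) := by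
    rw [Set.disjoint_left]
    rintro ω ⟨h1, -⟩ ⟨h2, -⟩
    exact zero_ne_one (h2.symm.trans h1)
  have hdisj' : Disjoint (A' 0) (A' 1 ∪ A 0) := by
    rw [Set.disjoint_left]
    rintro ω ⟨h1, h1'⟩ (⟨h2, -⟩ | ⟨-, h2⟩)
    · exact zero_ne_one (h1.symm.trans h2)
    · exact h1' h2
  have hune := measureReal_union (μ := inputLaw π σ) hdisj (hAm 0)
  have hd : 1 + d ≠ 0 := by positivity
  refine ⟨hg.trans ?_, ho.trans ?_, hr.trans ?_⟩
  · rw [probReal_compl_eq_one_sub ((hAm' 0).union ((hAm' 1).union (hAm 0))),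
      measureReal_union hdisj' ((hAm' 1).union (hAm 0)), hune, hA, hA', hA', hB0', hB1']
    field_simp
    ring
  · rw [hune, hA, hA', hB0', hB1']
    field_simp
    ring
  · rw [hA', hB0']
    field_simp
    ring

/-! ### Generating functions of critical and subcritical offspring laws -/

section GenFun

variable {a : ℕ → ℝ}

theorem summable_mul_pow (ha : ∀ k, 0 ≤ a k) (hs : Summable a) {x : ℝ} (hx : |x| ≤ 1) :
    Summable fun k => a k * x ^ k :=
  Summable.of_norm_bounded hs fun k => by
    rw [norm_mul, norm_pow, Real.norm_of_nonneg (ha k)]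
    exact mul_le_of_le_one_right (ha k) (pow_le_one₀ (norm_nonneg _) hx)

theorem continuousOn_genFun (ha : ∀ k, 0 ≤ a k) (hs : Summable a) :
    ContinuousOn (fun x : ℝ => ∑' k, a k * x ^ k) (Icc 0 1) := by
  refine continuousOn_tsum (fun k => by fun_prop) hs fun k x hx => ?_
  rw [norm_mul, norm_pow, Real.norm_of_nonneg (ha k), Real.norm_of_nonneg hx.1]
  exact mul_le_of_le_one_right (ha k) (pow_le_one₀ hx.1 hx.2)

theorem hasDerivAt_genFun (ha : ∀ k, 0 ≤ a k) (hs : Summable a)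
    (hm : Summable fun k : ℕ => k * a k) {x : ℝ} (hx : x ∈ Ioo (-1 : ℝ) 1) :
    HasDerivAt (fun x : ℝ => ∑' k, a k * x ^ k) (∑' k : ℕ, k * a k * x ^ (k - 1)) x := by
  refine hasDerivAt_tsum_of_isPreconnected (g := fun k x => a k * x ^ k)
    (g' := fun k x => k * a k * x ^ (k - 1)) (t := Ioo (-1 : ℝ) 1) (y₀ := 0) hm isOpen_Ioo
    isPreconnected_Ioo ?_ ?_ ?_ ?_ hx
  · intro k y _
    have := (hasDerivAt_pow k y).const_mul (a k)
    convert! this using 1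
    ring
  · intro k y hy
    rw [norm_mul, norm_pow, Real.norm_of_nonneg (mul_nonneg k.cast_nonneg (ha k))]
    exact mul_le_of_le_one_right (mul_nonneg k.cast_nonneg (ha k))
      (pow_le_one₀ (norm_nonneg _) (abs_le.2 ⟨hy.1.le, hy.2.le⟩))
  · constructor <;> norm_num
  · exact summable_mul_pow ha hs (by simp)

theorem genFun_deriv_nonneg (ha : ∀ k, 0 ≤ a k) {x : ℝ} (hx : 0 ≤ x) :
    0 ≤ ∑' k : ℕ, k * a k * x ^ (k - 1) :=
  tsum_nonneg fun k => mul_nonneg (mul_nonneg k.cast_nonneg (ha k)) (pow_nonneg hx _)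

/-- If some a_k with k ≥ 2 is positive, the factor x^(k-1) < 1 makes the bound by the mean strict.
Otherwise the mean is a_1, which is less than 1 because a_0 > 0. -/
theorem genFun_deriv_lt_one (ha : ∀ k, 0 ≤ a k) (hs : HasSum a 1)
    (hm : Summable fun k : ℕ => k * a k) (hm1 : ∑' k : ℕ, k * a k ≤ 1) (h0 : 0 < a 0) {x : ℝ}
    (hx0 : 0 ≤ x) (hx1 : x < 1) : ∑' k : ℕ, k * a k * x ^ (k - 1) < 1 := by
  have hle : ∀ k : ℕ, k * a k * x ^ (k - 1) ≤ k * a k := fun k =>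
    mul_le_of_le_one_right (mul_nonneg k.cast_nonneg (ha k)) (pow_le_one₀ hx0 hx1.le)
  have hsx : Summable fun k : ℕ => k * a k * x ^ (k - 1) :=
    Summable.of_nonneg_of_le
      (fun k => mul_nonneg (mul_nonneg k.cast_nonneg (ha k)) (pow_nonneg hx0 _)) hle hm
  by_cases h : ∃ k, 2 ≤ k ∧ 0 < a k
  · obtain ⟨k, hk, hak⟩ := h
    refine (Summable.tsum_lt_tsum (i := k) hle ?_ hsx hm).trans_le hm1
    have : (0 : ℝ) < k := by exact_mod_cast (by omega : 0 < k)
    exact mul_lt_of_lt_one_right (by positivity) (pow_lt_one₀ hx0 hx1 (by omega))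
  · have hk : ∀ k : ℕ, k * a k ≤ a k := by
      intro k
      rcases k with _ | _ | k
      · simpa using h0.le
      · simp
      · have : a (k + 2) = 0 := by
          by_contra hne
          exact h ⟨k + 2, by omega, lt_of_le_of_ne (ha _) (Ne.symm hne)⟩
        simp [this]
    calc ∑' k : ℕ, k * a k * x ^ (k - 1) ≤ ∑' k : ℕ, k * a k := hsx.tsum_le_tsum hle hm
      _ < ∑' k, a k := Summable.tsum_lt_tsum (i := 0) hk (by simpa using h0) hm hs.summable
      _ = 1 := hs.tsum_eq

/-- A fixed point x < 1 besides the fixed point 1 would, by the mean value theorem, give a point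
between them with derivative 1. -/
theorem genFun_eq_self (ha : ∀ k, 0 ≤ a k) (hs : HasSum a 1)
    (hm : Summable fun k : ℕ => k * a k) (hm1 : ∑' k : ℕ, k * a k ≤ 1) (h0 : 0 < a 0) {x : ℝ}
    (hx : x ∈ Icc (0 : ℝ) 1) (h : x = ∑' k, a k * x ^ k) : x = 1 := by
  by_contra hne
  have hx1 : x < 1 := lt_of_le_of_ne hx.2 hne
  have hderiv : ∀ y ∈ Ioo x 1, HasDerivAt (fun x : ℝ => ∑' k, a k * x ^ k)
      (∑' k : ℕ, k * a k * y ^ (k - 1)) y := fun y hy =>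
    hasDerivAt_genFun ha hs.summable hm ⟨by linarith [hx.1, hy.1], hy.2⟩
  obtain ⟨c, hc, hc'⟩ := exists_hasDerivAt_eq_slope _ _ hx1
    ((continuousOn_genFun ha hs.summable).mono (Icc_subset_Icc_left hx.1)) hderiv
  have hlt := genFun_deriv_lt_one ha hs hm hm1 h0 (hx.1.trans hc.1.le) hc.2
  simp only [one_pow, mul_one, hs.tsum_eq] at hc'
  rw [hc', ← h, div_self (by linarith)] at hlt
  exact lt_irrefl _ hlt

theorem genFun_mono (ha : ∀ k, 0 ≤ a k) (hs : Summable a) {x y : ℝ} (hx : 0 ≤ x) (hxy : x ≤ y)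
    (hy : y ≤ 1) : ∑' k, a k * x ^ k ≤ ∑' k, a k * y ^ k :=
  Summable.tsum_le_tsum (fun k => mul_le_mul_of_nonneg_left (pow_le_pow_left₀ hx hxy k) (ha k))
    (summable_mul_pow ha hs (abs_le.2 ⟨by linarith, by linarith⟩))
    (summable_mul_pow ha hs (abs_le.2 ⟨by linarith, by linarith⟩))

/-- The right-hand side is nonincreasing in q, so the larger of two solutions is also at most the
smaller. -/
theorem genFun_one_sub_unique (ha : ∀ k, 0 ≤ a k) (hs : Summable a) {q q' : ℝ}
    (hq : q ∈ Icc (0 : ℝ) 1) (hq' : q' ∈ Icc (0 : ℝ) 1) (h : q = ∑' k, a k * (1 - q) ^ k)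
    (h' : q' = ∑' k, a k * (1 - q') ^ k) : q' = q := by
  rcases le_total q q' with hle | hle
  · refine le_antisymm ?_ hle
    rw [h, h']
    exact genFun_mono ha hs (by linarith [hq'.2]) (by linarith) (by linarith [hq.1])
  · refine le_antisymm hle ?_
    rw [h, h']
    exact genFun_mono ha hs (by linarith [hq.2]) (by linarith) (by linarith [hq'.1])

theorem genFun_pos (ha : ∀ k, 0 ≤ a k) (hs : Summable a) (h0 : 0 < a 0) {x : ℝ}
    (hx : x ∈ Icc (0 : ℝ) 1) : 0 < ∑' k, a k * x ^ k :=
  (summable_mul_pow ha hs (abs_le.2 ⟨by linarith [hx.1], hx.2⟩)).tsum_pos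
    (fun k => mul_nonneg (ha k) (pow_nonneg hx.1 k)) 0 (by simpa using h0)

end GenFun

/-! ### The function `ψ` -/

theorem le_of_add_self_le_add_self {x y : ℝ≥0∞} (h : x + x ≤ y + y) : x ≤ y := by
  by_contra! hlt
  exact absurd h (not_le.2 (ENNReal.add_lt_add hlt hlt))

/-- The power series `x φ'(x)`. -/
noncomputable def phiDeriv (w : ℕ → ℝ≥0) (x : ℝ≥0∞) : ℝ≥0∞ :=
  ∑' i : ℕ, (i : ℝ≥0∞) * (w i : ℝ≥0∞) * x ^ i

/-- Monotonicity of ψ in a form without quotients. After symmetrisation in (i, j), the terms for i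
and i + m differ by w_i w_{i+m} (xy)^i m (y^m - x^m) ≥ 0. Doubling both sides performs the
symmetrisation without subtraction in `ℝ≥0∞`. -/
theorem phiDeriv_mul_phi_le (w : ℕ → ℝ≥0) {x y : ℝ≥0∞} (hxy : x ≤ y) :
    phiDeriv w x * phi w y ≤ phiDeriv w y * phi w x := by
  have hmul : ∀ x y, phiDeriv w x * phi w y =
      ∑' i : ℕ, ∑' j : ℕ, (i : ℝ≥0∞) * (w i) * x ^ i * ((w j) * y ^ j) := by
    intro x y
    rw [phiDeriv, phi, ← ENNReal.tsum_mul_right]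
    simp_rw [ENNReal.tsum_mul_left]
  have hdouble : ∀ f : ℕ → ℕ → ℝ≥0∞, (∑' i, ∑' j, f i j) + ∑' i, ∑' j, f i j =
      ∑' i, ∑' j, (f i j + f j i) := by
    intro f
    conv_lhs => rhs; rw [ENNReal.tsum_comm]
    simp_rw [← ENNReal.tsum_add]
  have key : ∀ i m : ℕ, (i : ℝ≥0∞) * (w i) * x ^ i * ((w (i + m)) * y ^ (i + m)) +
      ((i + m : ℕ) : ℝ≥0∞) * (w (i + m)) * x ^ (i + m) * ((w i) * y ^ i) ≤
      (i : ℝ≥0∞) * (w i) * y ^ i * ((w (i + m)) * x ^ (i + m)) +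
      ((i + m : ℕ) : ℝ≥0∞) * (w (i + m)) * y ^ (i + m) * ((w i) * x ^ i) := by
    intro i m
    have h1 : (i : ℝ≥0∞) * (w i) * x ^ i * ((w (i + m)) * y ^ (i + m)) +
      ((i + m : ℕ) : ℝ≥0∞) * (w (i + m)) * x ^ (i + m) * ((w i) * y ^ i) =
      (w i) * (w (i + m)) * x ^ i * y ^ i * (i * (x ^ m + y ^ m) + m * x ^ m) := by
      push_cast; ring
    have h2 : (i : ℝ≥0∞) * (w i) * y ^ i * ((w (i + m)) * x ^ (i + m)) +
      ((i + m : ℕ) : ℝ≥0∞) * (w (i + m)) * y ^ (i + m) * ((w i) * x ^ i) =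
      (w i) * (w (i + m)) * x ^ i * y ^ i * (i * (x ^ m + y ^ m) + m * y ^ m) := by
      push_cast; ring
    rw [h1, h2]
    gcongr
  refine le_of_add_self_le_add_self ?_
  rw [hmul, hmul, hdouble, hdouble]
  refine ENNReal.tsum_le_tsum fun i => ENNReal.tsum_le_tsum fun j => ?_
  rcases le_total i j with h | h
  · obtain ⟨m, rfl⟩ := Nat.exists_eq_add_of_le h
    exact key i m
  · obtain ⟨m, rfl⟩ := Nat.exists_eq_add_of_le h
    rw [add_comm, add_comm ((((j + m : ℕ) : ℝ≥0∞) * _ * _ * _))]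
    exact key j m

theorem phi_ne_zero {w : ℕ → ℝ≥0} (hw0 : 0 < w 0) (x : ℝ≥0∞) : phi w x ≠ 0 := by
  have := ENNReal.le_tsum (f := fun i : ℕ => (w i : ℝ≥0∞) * x ^ i) 0
  simp only [pow_zero, mul_one] at this
  exact (lt_of_lt_of_le (by exact_mod_cast hw0) this).ne'

/-- Finiteness at `y` matters, since a quotient by ∞ is 0 by convention. -/
theorem psi_le_psi {w : ℕ → ℝ≥0} (hw0 : 0 < w 0) {x y : ℝ≥0∞} (hxy : x ≤ y)
    (hy : phi w y ≠ ⊤) : psi w x ≤ psi w y := by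
  have hx : phi w x ≠ ⊤ := ne_top_of_le_ne_top hy
    (ENNReal.tsum_le_tsum fun i => by gcongr)
  change phiDeriv w x / phi w x ≤ phiDeriv w y / phi w y
  rw [ENNReal.div_le_iff (phi_ne_zero hw0 x) hx, mul_comm, ← mul_div_assoc,
    ENNReal.le_div_iff_mul_le (.inl (phi_ne_zero hw0 y)) (.inl hy), mul_comm (phi w x)]
  exact phiDeriv_mul_phi_le w hxy

theorem phi_ne_top {w : ℕ → ℝ≥0} {x : ℝ≥0∞} (hx : x < radius w) : phi w x ≠ ⊤ := by
  lift x to ℝ≥0 using hx.ne_top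
  have h := FormalMultilinearSeries.summable_norm_mul_pow _ hx
  simp only [FormalMultilinearSeries.ofScalars_norm] at h
  have h' : Summable fun i => w i * x ^ i := by
    rw [← NNReal.summable_coe]
    simpa using h
  rw [phi]
  exact_mod_cast ENNReal.tsum_coe_ne_top_iff_summable.2 h'

/-- Partial sums are continuous up to `r`, so each of them inherits the bound. -/
theorem tsum_mul_pow_le {c : ℕ → ℝ≥0∞} (hc : ∀ i, c i ≠ ⊤) {r M : ℝ≥0∞} (hr : 0 < r)
    (h : ∀ x < r, ∑' i, c i * x ^ i ≤ M) : ∑' i, c i * r ^ i ≤ M := by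
  rw [ENNReal.tsum_eq_iSup_sum]
  refine iSup_le fun s => ?_
  have hcont : Continuous fun x : ℝ≥0∞ => ∑ i ∈ s, c i * x ^ i :=
    continuous_finsetSum _ fun i _ =>
      (ENNReal.continuous_const_mul (hc i)).comp (ENNReal.continuous_pow i)
  have := nhdsLT_neBot_of_exists_lt ⟨0, hr⟩
  have ht : Tendsto (fun x : ℝ≥0∞ => ∑ i ∈ s, c i * x ^ i) (𝓝[<] r) (𝓝 (∑ i ∈ s, c i * r ^ i)) :=
    (hcont.tendsto r).mono_left nhdsWithin_le_nhds
  refine le_of_tendsto ht ?_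
  filter_upwards [self_mem_nhdsWithin] with x hx
  exact (ENNReal.sum_le_tsum s).trans (h x hx)

/-- Monotonicity guarantees that the limit defining ν exists, and identifies it with the supremum of
ψ below ρ. -/
theorem isLUB_nu {w : ℕ → ℝ≥0} (hw0 : 0 < w 0) (hr : 0 < radius w) :
    IsLUB (psi w '' Iio (radius w)) (nu w) := by
  have hmono : MonotoneOn (psi w) (Iio (radius w)) := fun x _ y hy hxy =>
    psi_le_psi hw0 hxy (phi_ne_top hy)
  have := nhdsLT_neBot_of_exists_lt ⟨0, hr⟩
  rw [nu, (hmono.tendsto_nhdsLT (OrderTop.bddAbove _)).limUnder_eq]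
  exact isLUB_sSup _

/-- In the second regime `φ(ρ)` is finite. -/
theorem phi_radius_ne_top {w : ℕ → ℝ≥0} (hw0 : 0 < w 0) (hr : 0 < radius w) (hν : nu w < 1) :
    phi w (radius w) ≠ ⊤ := by
  -- Combine φ ≤ w_0 + xφ' (every other index is at least 1) with xφ' ≤ νφ, and solve for φ(x),
  -- which is finite below ρ.
  have hle : ∀ x < radius w, phi w x ≤ w 0 / (1 - nu w) := by
    intro x hx
    have hfin := phi_ne_top hx
    have h1 : phiDeriv w x ≤ nu w * phi w x :=
      (ENNReal.div_le_iff (phi_ne_zero hw0 x) hfin).1 ((isLUB_nu hw0 hr).1 ⟨x, hx, rfl⟩)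
    have h2 : phi w x ≤ w 0 + phiDeriv w x := by
      have h3 : phi w x = w 0 + ∑' i : ℕ, (w (i + 1) : ℝ≥0∞) * x ^ (i + 1) := by
        rw [phi, tsum_eq_zero_add' ENNReal.summable, pow_zero, mul_one]
      have h4 : phiDeriv w x = ∑' i : ℕ, ((i + 1 : ℕ) : ℝ≥0∞) * w (i + 1) * x ^ (i + 1) := by
        rw [phiDeriv, tsum_eq_zero_add' ENNReal.summable, Nat.cast_zero, zero_mul, zero_mul,
          zero_add]
      rw [h3, h4]
      gcongr with i
      exact le_mul_of_one_le_left zero_le (by simp)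
    have h3 : nu w ≠ ⊤ := (hν.trans ENNReal.one_lt_top).ne
    rw [ENNReal.le_div_iff_mul_le (.inl (tsub_pos_of_lt hν).ne') (.inl (by simp)), ENNReal.mul_sub
      (fun _ _ => hfin), mul_one, tsub_le_iff_right, mul_comm]
    exact h2.trans (by gcongr)
  refine ne_top_of_le_ne_top ?_ (tsum_mul_pow_le (fun i => ENNReal.coe_ne_top) hr hle)
  exact ENNReal.div_ne_top ENNReal.coe_ne_top (tsub_pos_of_lt hν).ne'

theorem psi_radius {w : ℕ → ℝ≥0} (hw0 : 0 < w 0) (hr : 0 < radius w) (hν : nu w < 1) :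
    psi w (radius w) = nu w := by
  have hfin := phi_radius_ne_top hw0 hr hν
  have hlub := isLUB_nu hw0 hr
  refine le_antisymm ?_ (hlub.2 ?_)
  · refine (ENNReal.div_le_iff (phi_ne_zero hw0 _) hfin).2
      (tsum_mul_pow_le (fun i => ENNReal.mul_ne_top (by simp) ENNReal.coe_ne_top) hr ?_)
    intro x hx
    refine ((ENNReal.div_le_iff (phi_ne_zero hw0 x) (phi_ne_top hx)).1
      (hlub.1 ⟨x, hx, rfl⟩)).trans ?_
    gcongr
    exact ENNReal.tsum_le_tsum fun i => by gcongr
  · rintro _ ⟨x, hx, rfl⟩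
    exact psi_le_psi hw0 (le_of_lt hx) hfin

/-! ### The laws `π` and `π̂` -/

/-- What the first two regimes have in common. -/
structure IsSubcritical (w : ℕ → ℝ≥0) (τ : ℝ≥0∞) : Prop where
  hasSum_offspring : HasSum (offspring w τ) 1
  mean_le_one : ∑' k : ℕ, (k : ℝ≥0∞) * offspring w τ k ≤ 1
  offspring_zero_ne_zero : offspring w τ 0 ≠ 0
  hasSum_sizeBiased : HasSum (sizeBiased w τ) 1

theorem tsum_offspring {w : ℕ → ℝ≥0} (hw0 : 0 < w 0) {τ : ℝ≥0∞} (h : phi w τ ≠ ⊤) :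
    ∑' k, offspring w τ k = 1 := by
  simp only [offspring, div_eq_mul_inv, ENNReal.tsum_mul_right]
  have : ∑' i : ℕ, τ ^ i * (w i : ℝ≥0∞) = phi w τ := tsum_congr fun i => mul_comm _ _
  rw [this, ENNReal.mul_inv_cancel (phi_ne_zero hw0 τ) h]

theorem tsum_mul_offspring (w : ℕ → ℝ≥0) (τ : ℝ≥0∞) :
    ∑' k : ℕ, (k : ℝ≥0∞) * offspring w τ k = psi w τ := by
  rw [psi, div_eq_mul_inv, ← ENNReal.tsum_mul_right]
  refine tsum_congr fun k => ?_
  rw [offspring, div_eq_mul_inv]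
  ring

theorem tsum_sizeBiased (w : ℕ → ℝ≥0) (τ : ℝ≥0∞) :
    ∑' N, sizeBiased w τ N = (1 - min 1 (nu w)) + psi w τ := by
  rw [ENat.tsum_eq_top_add, ← tsum_mul_offspring]
  simp [sizeBiased]

/-- The finite part of π̂ has mass ψ(τ), the mean of π. The hypothesis `hψ` says that this
complements the mass 1 - m at ∞. -/
theorem isSubcritical {w : ℕ → ℝ≥0} (hw0 : 0 < w 0) {τ : ℝ≥0∞} (h : phi w τ ≠ ⊤)
    (hψ : psi w τ = min 1 (nu w)) : IsSubcritical w τ where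
  hasSum_offspring := (tsum_offspring hw0 h) ▸ ENNReal.summable.hasSum
  mean_le_one := by
    rw [tsum_mul_offspring, hψ]
    exact min_le_left _ _
  offspring_zero_ne_zero := by
    rw [offspring, pow_zero, one_mul]
    exact (ENNReal.div_pos (by exact_mod_cast hw0.ne') h).ne'
  hasSum_sizeBiased := by
    have : ∑' N, sizeBiased w τ N = 1 := by
      rw [tsum_sizeBiased, hψ, tsub_add_cancel_of_le (min_le_left _ _)]
    exact this ▸ ENNReal.summable.hasSum

/-- Division by φ(τ) = ∞ would give ψ(τ) = 0 instead of 1. -/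
theorem IsRegimeOne.phi_ne_top {w : ℕ → ℝ≥0} {τ : ℝ≥0∞} (h : IsRegimeOne w τ) :
    phi w τ ≠ ⊤ := by
  intro htop
  have := h.psi_tau
  simp [psi, htop, div_eq_mul_inv] at this

theorem IsRegimeOne.isSubcritical {w : ℕ → ℝ≥0} (hw0 : 0 < w 0) {τ : ℝ≥0∞}
    (h : IsRegimeOne w τ) : IsSubcritical w τ :=
  TreeColour.isSubcritical hw0 h.phi_ne_top (by rw [h.psi_tau, min_eq_left h.one_le_nu])

theorem IsRegimeTwo.isSubcritical {w : ℕ → ℝ≥0} (hw0 : 0 < w 0) {τ : ℝ≥0∞}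
    (h : IsRegimeTwo w τ) : IsSubcritical w τ := by
  obtain rfl := h.tau_eq
  refine TreeColour.isSubcritical hw0 (phi_radius_ne_top hw0 h.radius_pos h.nu_lt_one) ?_
  rw [psi_radius hw0 h.radius_pos h.nu_lt_one, min_eq_right h.nu_lt_one.le]

theorem pmfOf_apply {α : Type*} [Inhabited α] {f : α → ℝ≥0∞} (h : HasSum f 1) (a : α) :
    pmfOf f a = f a := by
  have : pmfOf f = ⟨f, h⟩ := dif_pos h
  rw [this]
  rfl

namespace IsSubcritical

variable {w : ℕ → ℝ≥0} {τ : ℝ≥0∞} (h : IsSubcritical w τ)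
include h

theorem offspringLaw_apply (k : ℕ) : offspringLaw w τ k = offspring w τ k :=
  pmfOf_apply h.hasSum_offspring k

theorem sizeBiasedLaw_apply (N : ℕ∞) : sizeBiasedLaw w τ N = sizeBiased w τ N :=
  pmfOf_apply h.hasSum_sizeBiased N

theorem offspring_ne_top (k : ℕ) : offspring w τ k ≠ ⊤ := by
  rw [← h.offspringLaw_apply]
  exact PMF.apply_ne_top _ _

theorem hasSum_toReal : HasSum (fun k => (offspring w τ k).toReal) 1 := by
  have := (ENNReal.summable_toReal (f := offspring w τ)
    (by rw [h.hasSum_offspring.tsum_eq]; simp)).hasSum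
  rwa [← ENNReal.tsum_toReal_eq h.offspring_ne_top, h.hasSum_offspring.tsum_eq,
    ENNReal.toReal_one] at this

theorem summable_mul_toReal : Summable fun k : ℕ => k * (offspring w τ k).toReal := by
  have := ENNReal.summable_toReal (f := fun k : ℕ => (k : ℝ≥0∞) * offspring w τ k)
    (ne_top_of_le_ne_top ENNReal.one_ne_top h.mean_le_one)
  simpa using this

theorem tsum_mul_toReal_le_one : ∑' k : ℕ, k * (offspring w τ k).toReal ≤ 1 := by
  have := ENNReal.toReal_mono ENNReal.one_ne_top h.mean_le_one
  rw [ENNReal.tsum_toReal_eq fun k =>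
    ENNReal.mul_ne_top (ENNReal.natCast_ne_top k) (h.offspring_ne_top k)] at this
  simpa using this

theorem offspring_zero_pos : 0 < (offspring w τ 0).toReal :=
  ENNReal.toReal_pos h.offspring_zero_ne_zero (h.offspring_ne_top 0)

theorem genFun_toReal {x : ℝ≥0∞} (hx : x ≤ 1) :
    (∑' k, offspringLaw w τ k * x ^ k).toReal = genFun w τ x.toReal := by
  have hx' : x ≠ ⊤ := ne_top_of_le_ne_top ENNReal.one_ne_top hx
  rw [ENNReal.tsum_toReal_eq fun k =>
    ENNReal.mul_ne_top (PMF.apply_ne_top _ _) (ENNReal.pow_ne_top hx'), genFun]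
  simp [h.offspringLaw_apply]

/-- The probability of finite height is a fixed point of G, and 1 is the only one in [0, 1]. -/
theorem treeLaw_finiteHeight_eq_one : treeLaw (offspringLaw w τ) {ξ | FiniteHeight ξ} = 1 := by
  set y := treeLaw (offspringLaw w τ) {ξ | FiniteHeight ξ} with hy
  have hy1 : y ≤ 1 := prob_le_one
  have hfix : y = ∑' k, offspringLaw w τ k * y ^ k := treeLaw_finiteHeight _
  have hfix' : y.toReal = genFun w τ y.toReal := by rw [← h.genFun_toReal hy1, ← hfix]
  have := genFun_eq_self (fun _ => ENNReal.toReal_nonneg) h.hasSum_toReal h.summable_mul_toReal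
    h.tsum_mul_toReal_le_one h.offspring_zero_pos (x := y.toReal)
    ⟨ENNReal.toReal_nonneg, ENNReal.toReal_le_of_le_ofReal zero_le_one (by simpa using hy1)⟩ hfix'
  rwa [ENNReal.toReal_eq_one_iff] at this

theorem treeLaw_rootRed_eq : treeLaw (offspringLaw w τ) {ξ | RootRed ξ} =
    treeLaw (offspringLaw w τ) {ξ | redCount ξ = 0} := by
  have hae : ∀ᵐ ξ ∂treeLaw (offspringLaw w τ), FiniteHeight ξ :=
    (prob_compl_eq_zero_iff measurableSet_finiteHeight).2 h.treeLaw_finiteHeight_eq_one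
  exact measure_congr (by filter_upwards [hae] with ξ hξ using propext hξ.rootRed_iff_redCount)

end IsSubcritical

/-- The probability that the root of a Bienaymé-Galton-Watson tree is red. -/
noncomputable def redProb (w : ℕ → ℝ≥0) (τ : ℝ≥0∞) : ℝ :=
  (treeLaw (offspringLaw w τ)).real {ξ | RootRed ξ}

theorem redProb_mem_Icc (w : ℕ → ℝ≥0) (τ : ℝ≥0∞) : redProb w τ ∈ Icc (0 : ℝ) 1 :=
  ⟨measureReal_nonneg, measureReal_le_one⟩

theorem toReal_one_sub_redProb (w : ℕ → ℝ≥0) (τ : ℝ≥0∞) :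
    (1 - treeLaw (offspringLaw w τ) {ξ | RootRed ξ}).toReal = 1 - redProb w τ := by
  rw [ENNReal.toReal_sub_of_le prob_le_one ENNReal.one_ne_top, ENNReal.toReal_one]
  rfl

namespace IsSubcritical

variable {w : ℕ → ℝ≥0} {τ : ℝ≥0∞} (h : IsSubcritical w τ)
include h

theorem redProb_eq : redProb w τ = genFun w τ (1 - redProb w τ) := by
  rw [← toReal_one_sub_redProb, ← h.genFun_toReal tsub_le_self, ← treeLaw_redCount_eq_zero,
    ← h.treeLaw_rootRed_eq]
  rfl

theorem redProb_unique {q : ℝ} (hq : q ∈ Icc (0 : ℝ) 1) (hq' : q = genFun w τ (1 - q)) :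
    q = redProb w τ :=
  genFun_one_sub_unique (fun _ => ENNReal.toReal_nonneg) h.hasSum_toReal.summable
    (redProb_mem_Icc w τ) hq h.redProb_eq hq'

/-- This keeps 1 - q away from the endpoint 1, where the termwise derivative is not available and
the strict bound on it may fail. -/
theorem redProb_pos : 0 < redProb w τ := by
  rw [h.redProb_eq]
  have := redProb_mem_Icc w τ
  exact genFun_pos (fun _ => ENNReal.toReal_nonneg) h.hasSum_toReal.summable h.offspring_zero_pos
    ⟨by linarith [this.2], by linarith [this.1]⟩

theorem deriv_genFun : deriv (genFun w τ) (1 - redProb w τ) =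
    ∑' k : ℕ, k * (offspring w τ k).toReal * (1 - redProb w τ) ^ (k - 1) :=
  (hasDerivAt_genFun (fun _ => ENNReal.toReal_nonneg) h.hasSum_toReal.summable
    h.summable_mul_toReal
    ⟨by linarith [(redProb_mem_Icc w τ).2], by linarith [h.redProb_pos]⟩).deriv

theorem deriv_genFun_nonneg : 0 ≤ deriv (genFun w τ) (1 - redProb w τ) := by
  rw [h.deriv_genFun]
  exact genFun_deriv_nonneg (fun _ => ENNReal.toReal_nonneg)
    (by linarith [(redProb_mem_Icc w τ).2])

theorem deriv_genFun_lt_one : deriv (genFun w τ) (1 - redProb w τ) < 1 := by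
  rw [h.deriv_genFun]
  exact genFun_deriv_lt_one (fun _ => ENNReal.toReal_nonneg) h.hasSum_toReal
    h.summable_mul_toReal h.tsum_mul_toReal_le_one h.offspring_zero_pos
    (by linarith [(redProb_mem_Icc w τ).2]) (by linarith [h.redProb_pos])

theorem treeLaw_redCount_zero :
    treeLaw (offspringLaw w τ) {ξ | redCount ξ = 0} = ENNReal.ofReal (redProb w τ) := by
  rw [← h.treeLaw_rootRed_eq, redProb, ofReal_measureReal]

theorem treeLaw_redCount_one : treeLaw (offspringLaw w τ) {ξ | redCount ξ = 1} =
    ENNReal.ofReal (redProb w τ * deriv (genFun w τ) (1 - redProb w τ)) := by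
  rw [← ENNReal.ofReal_toReal (measure_ne_top (treeLaw (offspringLaw w τ)) {ξ | redCount ξ = 1}),
    treeLaw_redCount_eq_one, ENNReal.tsum_toReal_eq, h.deriv_genFun, ← tsum_mul_left]
  · congr 1
    refine tsum_congr fun k => ?_
    simp only [ENNReal.toReal_mul, ENNReal.toReal_pow, toReal_one_sub_redProb, ENNReal.toReal_natCast,
      h.offspringLaw_apply]
    rw [← measureReal_def, ← redProb]
    ring
  · intro k
    exact ENNReal.mul_ne_top (PMF.apply_ne_top _ _) (ENNReal.mul_ne_top (ENNReal.natCast_ne_top k)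
      (ENNReal.mul_ne_top (measure_ne_top _ _) (ENNReal.pow_ne_top (by simp))))

/-- With π̂_{n+1} = (n + 1) π_{n+1}, the generating function of the number of siblings is G'; mass
at ∞ contributes nothing. -/
theorem sideLaw_openSides_eq : sideLaw (offspringLaw w τ) (siblingLaw w τ) openSides =
    ENNReal.ofReal (deriv (genFun w τ) (1 - redProb w τ)) := by
  have h0 : sizeBiasedLaw w τ 0 = 0 := by
    rw [h.sizeBiasedLaw_apply]
    simp [sizeBiased]
  have hsucc : ∀ n : ℕ, sizeBiasedLaw w τ ((n + 1 : ℕ) : ℕ∞) =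
      ((n + 1 : ℕ) : ℝ≥0∞) * offspring w τ (n + 1) := by
    intro n
    rw [h.sizeBiasedLaw_apply, sizeBiased, if_neg (ENat.natCast_ne_top _), ENat.toNat_natCast]
  rw [← ENNReal.ofReal_toReal (measure_ne_top (sideLaw _ _) openSides), sideLaw_openSides,
    tsum_siblingLaw_mul w τ h0, ENNReal.tsum_toReal_eq, h.deriv_genFun]
  · have hq := redProb_mem_Icc w τ
    have hsum : Summable fun k : ℕ =>
        k * (offspring w τ k).toReal * (1 - redProb w τ) ^ (k - 1) :=
      Summable.of_nonneg_of_le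
        (fun k => mul_nonneg (by positivity) (pow_nonneg (by linarith [hq.2]) _))
        (fun k => mul_le_of_le_one_right (by positivity)
          (pow_le_one₀ (by linarith [hq.2]) (by linarith [hq.1]))) h.summable_mul_toReal
    rw [hsum.tsum_eq_zero_add, Nat.cast_zero, zero_mul, zero_mul, zero_add]
    congr 1
    refine tsum_congr fun n => ?_
    rw [hsucc]
    simp only [ENNReal.toReal_mul, ENNReal.toReal_pow, ENNReal.toReal_natCast,
      toReal_one_sub_redProb, Nat.add_sub_cancel]
  · intro n
    exact ENNReal.mul_ne_top (PMF.apply_ne_top _ _) (ENNReal.pow_ne_top (by simp))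

theorem isColourLaw {E : Colour → Sample → Prop}
    (hE : ∀ᵐ ω ∂sampleLaw w τ, ∀ n, (∀ k < n, ¬ Blocks ω k) → Blocks ω n →
      ∀ c, E c ω ↔ finalColour ω n = c) :
    IsColourLaw (fun c => (sampleLaw w τ).real {ω | E c ω}) (redProb w τ)
      (deriv (genFun w τ) (1 - redProb w τ)) :=
  isColourLaw_of_ae (redProb_mem_Icc w τ).1 h.deriv_genFun_nonneg h.deriv_genFun_lt_one
    h.treeLaw_redCount_zero h.treeLaw_redCount_one h.sideLaw_openSides_eq hE

theorem ae_finiteHeight : ∀ᵐ ω ∂sampleLaw w τ, ∀ b, FiniteHeight (attached ω b) :=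
  ae_finiteHeight_attached _ h.treeLaw_finiteHeight_eq_one

theorem siblingLaw_ne_zero {N : ℕ∞} (hN : sizeBiased w τ N ≠ 0) {y : ℕ∞ × ℕ∞}
    (hy : (if N = ⊤ then PMF.pure (⊤, ⊤) else positionLaw N.toNat) y ≠ 0) :
    siblingLaw w τ y ≠ 0 := by
  rw [siblingLaw, ← PMF.mem_support_iff, PMF.mem_support_bind_iff]
  exact ⟨N, by rwa [PMF.mem_support_iff, h.sizeBiasedLaw_apply], hy⟩

end IsSubcritical

theorem add_ne_top_of_mem_support_positionLaw {n : ℕ} {y : ℕ∞ × ℕ∞}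
    (hy : y ∈ (positionLaw n).support) : y.1 + y.2 ≠ ⊤ := by
  cases n with
  | zero =>
    rw [positionLaw, PMF.support_pure, Set.mem_singleton_iff] at hy
    simp [hy]
  | succ n =>
    rw [positionLaw, PMF.support_map] at hy
    obtain ⟨j, -, rfl⟩ := hy
    simp

theorem positionLaw_ne_zero (n : ℕ) : positionLaw (n + 1) (0, (n : ℕ∞)) ≠ 0 := by
  have hlaw : positionLaw (n + 1) = ((PMF.uniformOfFintype (Fin (n + 1))).bind
      fun j => PMF.pure (j : ℕ)).map
        (fun j : ℕ => ((j : ℕ∞), ((n - j : ℕ) : ℕ∞))) := rfl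
  rw [hlaw, ← PMF.mem_support_iff, PMF.support_map]
  refine ⟨0, ?_, by simp⟩
  rw [PMF.mem_support_bind_iff]
  exact ⟨0, by simp, by simp⟩

/-! ### The two kinds of infinite trees -/

theorem IsRegimeOne.ae_not_infiniteAt {w : ℕ → ℝ≥0} (hw0 : 0 < w 0) {τ : ℝ≥0∞}
    (h : IsRegimeOne w τ) : ∀ᵐ ω ∂sampleLaw w τ, ∀ k, ¬ InfiniteAt ω.2 k := by
  refine TreeColour.ae_not_infiniteAt _ fun y hy => ?_
  by_contra hne
  rw [siblingLaw, ← ne_eq, ← PMF.mem_support_iff, PMF.mem_support_bind_iff] at hne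
  obtain ⟨N, hN, hyN⟩ := hne
  rw [PMF.mem_support_iff, (h.isSubcritical hw0).sizeBiasedLaw_apply] at hN
  split_ifs at hyN with htop
  · rw [sizeBiased, if_pos htop, min_eq_left h.one_le_nu, tsub_self] at hN
    exact hN rfl
  · exact add_ne_top_of_mem_support_positionLaw hyN hy

/-- Here τ > 0, because ψ(0) = 0. -/
theorem IsRegimeOne.offspring_ne_zero {w : ℕ → ℝ≥0} {τ : ℝ≥0∞} (h : IsRegimeOne w τ)
    {k : ℕ} (hk : 0 < w k) : offspring w τ k ≠ 0 := by
  have hτ : τ ≠ 0 := by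
    rintro rfl
    have := h.psi_tau
    have h0 : ∑' i : ℕ, (i : ℝ≥0∞) * (w i : ℝ≥0∞) * (0 : ℝ≥0∞) ^ i = 0 := by
      rw [ENNReal.tsum_eq_zero]
      intro i
      cases i <;> simp
    rw [psi, h0, ENNReal.zero_div] at this
    exact zero_ne_one this
  exact (ENNReal.div_pos (mul_ne_zero (pow_ne_zero _ hτ) (by exact_mod_cast hk.ne'))
    h.phi_ne_top).ne'

/-- With positive probability a spine vertex has k ≥ 3 children, the spine continues through the
leftmost, and the next two are red. Independence makes this happen infinitely often. -/
theorem IsRegimeOne.ae_frequently_nontrivial {w : ℕ → ℝ≥0} (hw0 : 0 < w 0) {τ : ℝ≥0∞}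
    (h : IsRegimeOne w τ) (hw : ∃ k, 3 ≤ k ∧ 0 < w k) :
    ∀ᵐ ω ∂sampleLaw w τ, ∃ᶠ k in atTop, (redSides ω k).Nontrivial := by
  obtain ⟨k, hk, hwk⟩ := hw
  obtain ⟨n, rfl⟩ : ∃ n, k = n + 3 := ⟨k - 3, by omega⟩
  have hs := h.isSubcritical hw0
  have hσ : siblingLaw w τ (0, ((n + 2 : ℕ) : ℕ∞)) ≠ 0 := by
    refine hs.siblingLaw_ne_zero (N := ((n + 3 : ℕ) : ℕ∞)) ?_ ?_
    · rw [sizeBiased, if_neg (ENat.natCast_ne_top _), ENat.toNat_natCast]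
      exact mul_ne_zero (by simp) (h.offspring_ne_zero hwk)
    · rw [if_neg (ENat.natCast_ne_top _), ENat.toNat_natCast]
      exact positionLaw_ne_zero (n + 2)
  have hred : treeLaw (offspringLaw w τ) {ξ | RootRed ξ} ≠ 0 := by
    have := hs.redProb_pos
    rw [redProb, measureReal_def, ENNReal.toReal_pos_iff] at this
    exact this.1.ne'
  have hpos := sideLaw_twoRed_ne_zero (offspringLaw w τ) (siblingLaw w τ) hσ (true, 0) (true, 1)
    hred
  have := ae_frequently_decompose (offspringLaw w τ) (siblingLaw w τ)
    (measurableSet_twoRed _ _ _) hpos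
  filter_upwards [this] with ω hω
  refine hω.mono fun k hk => ?_
  obtain ⟨hy, h0, h1⟩ := hk
  have hpres : ∀ i < n + 2, BasePresent ω.2 (some (k, true, i)) := by
    intro i hi
    change (i : ℕ∞) < (ω.2 k).2
    rw [show ω.2 k = (0, ((n + 2 : ℕ) : ℕ∞)) from hy, Nat.cast_lt]
    exact hi
  exact ⟨(true, 0), ⟨hpres 0 (by omega), h0⟩, (true, 1), ⟨hpres 1 (by omega), h1⟩, by simp⟩

/-- Since ν < 1, π̂ has positive mass at ∞. Two occurrences along the spine are enough to define the
truncated tree. -/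
theorem IsRegimeTwo.ae_frequently_infiniteAt {w : ℕ → ℝ≥0} (hw0 : 0 < w 0) {τ : ℝ≥0∞}
    (h : IsRegimeTwo w τ) : ∀ᵐ ω ∂sampleLaw w τ, ∃ᶠ k in atTop, InfiniteAt ω.2 k := by
  have hσ : siblingLaw w τ (⊤, ⊤) ≠ 0 := by
    refine (h.isSubcritical hw0).siblingLaw_ne_zero (N := ⊤) ?_ ?_
    · rw [sizeBiased, if_pos rfl, min_eq_right h.nu_lt_one.le]
      exact (tsub_pos_of_lt h.nu_lt_one).ne'
    · rw [if_pos rfl]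
      simp
  have hpos : sideLaw (offspringLaw w τ) (siblingLaw w τ) (univ ×ˢ {((⊤ : ℕ∞), (⊤ : ℕ∞))}) ≠ 0 := by
    rw [sideLaw, prod_prod, measure_univ, one_mul,
      PMF.toMeasure_apply_singleton _ _ (measurableSet_singleton _)]
    exact hσ
  have := ae_frequently_decompose (offspringLaw w τ) (siblingLaw w τ)
    (MeasurableSet.univ.prod (measurableSet_singleton _)) hpos
  filter_upwards [this] with ω hω
  refine hω.mono fun k hk => ?_
  have : ω.2 k = (⊤, ⊤) := hk.2
  simp [InfiniteAt, this]

theorem probThree_red : probThree Colour.red = 1 := by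
  have : colourThree treeThree (u 0) = Colour.red := by
    rw [colourThree, if_neg]
    rintro ⟨x, rfl | hx, hp⟩
    · cases hp
    · rw [hp] at hx
      cases hx
  rw [probThree, PMF.toOuterMeasure_pure_apply, if_pos (by exact this), ENNReal.toReal_one]

end TreeColour

open TreeColour

theorem mainTheorem5 (w : ℕ → ℝ≥0) (hw0 : 0 < w 0) (hw : ∃ k, 1 ≤ k ∧ 0 < w k) :
    (∀ τ : ℝ≥0∞, IsRegimeOne w τ →
      ∃ q : ℝ, (q ∈ Set.Icc (0 : ℝ) 1 ∧ q = genFun w τ (1 - q)) ∧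
        (∀ q' : ℝ, q' ∈ Set.Icc (0 : ℝ) 1 → q' = genFun w τ (1 - q') → q' = q) ∧
        ((∃ k, 3 ≤ k ∧ 0 < w k) →
          IsColourLaw (probOne w τ) q (deriv (genFun w τ) (1 - q))) ∧
        IsColourLaw (probLimit w τ) q (deriv (genFun w τ) (1 - q))) ∧
    (∀ τ : ℝ≥0∞, IsRegimeTwo w τ →
      ∃ q : ℝ, (q ∈ Set.Icc (0 : ℝ) 1 ∧ q = genFun w τ (1 - q)) ∧
        (∀ q' : ℝ, q' ∈ Set.Icc (0 : ℝ) 1 → q' = genFun w τ (1 - q') → q' = q) ∧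
        IsColourLaw (probTwo w τ) q (deriv (genFun w τ) (1 - q))) ∧
    (IsRegimeThree w → probThree Colour.red = 1) := by
  refine ⟨fun τ h => ?_, fun τ h => ?_, fun _ => probThree_red⟩
  · have hs := h.isSubcritical hw0
    refine ⟨redProb w τ, ⟨redProb_mem_Icc w τ, hs.redProb_eq⟩,
      fun q' hq hq' => hs.redProb_unique hq hq', fun hw3 => hs.isColourLaw ?_, hs.isColourLaw ?_⟩
    · filter_upwards [hs.ae_finiteHeight, h.ae_not_infiniteAt hw0,
        h.ae_frequently_nontrivial hw0 hw3] with ω h1 h2 h3 n hn hb c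
      exact hasColourOne_iff h1 h2 hn hb h3 c
    · filter_upwards [hs.ae_finiteHeight, h.ae_not_infiniteAt hw0] with ω h1 h2 n hn hb c
      exact hasLimitColour_iff h1 h2 hn hb c
  · have hs := h.isSubcritical hw0
    refine ⟨redProb w τ, ⟨redProb_mem_Icc w τ, hs.redProb_eq⟩,
      fun q' hq hq' => hs.redProb_unique hq hq', hs.isColourLaw ?_⟩
    filter_upwards [hs.ae_finiteHeight, h.ae_frequently_infiniteAt hw0] with ω h1 h2 n hn hb c
    obtain ⟨k, hk⟩ := exists_secondInfiniteAt h2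
    rw [colourTwo_eq h1 hk hn hb]
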